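/- Let $q=e^{2\pi i z}$ with $z$ in the upper half-plane $\mathbb H$, and set $$M_2(z)=2E_2(2z)-E_2(z),\qquad M_4(z)=\tfrac15\bigl(4E_4(2z)+E_4(z)\bigr),\qquad M_8(z)=\eta(z)^8\eta(2z)^8,$$ where $E_2,E_4$ are the normalized Eisenstein series of level one and $\eta$ is the Dedekind eta function. For an integer $w$, an integer $r\ge 0$ and a sign $\epsilon\in\{\pm1\}$, let $\widetilde{\mathscr M}_w^{\le r}(\Gamma_0^+(2),\epsilon)$ be the space of quasimodular forms of weight $w$ and depth at most $r$: the holomorphic parts $f_0$ of functions $F(z)=\sum_{j=0}^r f_j(z)/(z-\bar z)^j$, with $f_j$ holomorphic on $\mathbb H$, such that $F|_w\gamma=F$ for all $\gamma\in\Gamma_0(2)$, $F|_w\gamma=\epsilon F$ for all $\gamma$ in the Atkin–Lehner coset $W_2$ of matrices $\frac1{\sqrt2}\begin{pmatrix}2a&b\\2c&2d\end{pmatrix}$ ($a,b,c,d\in\mathbb Z$, $4ad-2bc=2$), and $F$ has a finite limit at every cusp of $\Gamma_0(2)$. An element $f$ of such a space is called extremal if its vanishing order at $\infty$ (the index of the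 first nonzero coefficient of its $q$-expansion) equals the dimension of the space minus $1$. Then $M_4=M_2^2$, and for every integer $k\ge0$ and every holomorphic branch of $M_8^{k/2}$ on $\mathbb H$ (a holomorphic function whose square is $M_8^k$) the following hold. (i) If $f$ is extremal in $\widetilde{\mathscr M}_{4k}^{\le1}(\Gamma_0^+(2),(-1)^k)$, then $y=f/M_8^{k/2}$ is a holomorphic solution on $\mathbb H$ of $$y''(z)=-4\pi^2\left(\frac k2\right)^2M_4(z)\,y(z).$$ (ii) If $f$ is extremal in $\widetilde{\mathscr M}_{4k+2}^{\le1}(\Gamma_0^+(2),(-1)^k)$, then $y=f/(M_8^{k/2}M_2)$ is meromorphic on $\mathbb H$ and, on the set of points of $\mathbb H$ where $M_4\ne0$, it is a holomorphic solution of $$y''(z)=-4\pi^2\left(\left(\frac k2\right)^2M_4(z)-32\,\frac{M_8(z)}{M_4(z)}\right)y(z).$$ -/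

import Mathlib

open UpperHalfPlane Filter Topology
open scoped MatrixGroups ModularForm Manifold ComplexConjugate

noncomputable section

namespace QuasiLevelTwo

/-- The function `∑_{j ≤ r} f_j(z) / (z - z̄)^j` on the upper half plane. -/
def nearlySum (r : ℕ) (f : ℕ → ℍ → ℂ) : ℍ → ℂ := fun z =>
  ∑ j ∈ Finset.range (r + 1), f j z / ((z : ℂ) - conj (z : ℂ)) ^ j

/-- The Atkin-Lehner coset `W₂` of `Γ₀(2)`: all matrices `(1/√2) (2a, b; 2c, 2d)` with integers
`a, b, c, d` and determinant one, that is, `4ad - 2bc = 2`. -/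
def atkinLehnerCoset : Set (GL (Fin 2) ℝ) :=
  {γ | ∃ a b c d : ℤ, 4 * a * d - 2 * b * c = 2 ∧
    (γ : Matrix (Fin 2) (Fin 2) ℝ) =
      (1 / √2 : ℝ) • !![2 * (a : ℝ), (b : ℝ); 2 * (c : ℝ), 2 * (d : ℝ)]}

/-- The modularity and cusp conditions for a function `F` on the upper half plane: weight `k`
invariance under `Γ₀(2)`, eigenvalue `s` under the Atkin-Lehner coset `W₂`, and a finite limit at
every cusp of `Γ₀(2)`. -/
structure IsModularWithSign (k : ℤ) (s : ℤˣ) (F : ℍ → ℂ) : Prop where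
  invariant : ∀ γ : SL(2, ℤ), γ ∈ CongruenceSubgroup.Gamma0 2 → F ∣[k] γ = F
  sign : ∀ γ ∈ atkinLehnerCoset, F ∣[k] γ = (((s : ℤ) : ℂ)) • F
  cusps : ∀ γ : SL(2, ℤ), ∃ L : ℂ, Tendsto (F ∣[k] γ) atImInfty (𝓝 L)

/-- `f` is the holomorphic part of a nearly holomorphic modular form of weight `k` and depth at
most `r` for `Γ₀⁺(2)` with sign `s`. -/
def IsQuasimodular (k : ℤ) (r : ℕ) (s : ℤˣ) (f : ℍ → ℂ) : Prop :=
  ∃ c : ℕ → ℍ → ℂ, c 0 = f ∧ (∀ j ≤ r, MDiff (c j)) ∧ IsModularWithSign k s (nearlySum r c)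

lemma nearlySum_add (r : ℕ) (f g : ℕ → ℍ → ℂ) :
    nearlySum r (f + g) = nearlySum r f + nearlySum r g := by
  ext z
  simp [nearlySum, add_div, Finset.sum_add_distrib]

lemma nearlySum_smul (r : ℕ) (a : ℂ) (f : ℕ → ℍ → ℂ) :
    nearlySum r (a • f) = a • nearlySum r f := by
  ext z
  simp [nearlySum, Finset.mul_sum, mul_div_assoc]

lemma det_pos_of_mem {γ : GL (Fin 2) ℝ} (h : γ ∈ atkinLehnerCoset) : 0 < γ.det.val := by
  obtain ⟨a, b, c, d, h1, h2⟩ := h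
  have h3 : (4 * a * d - 2 * b * c : ℝ) = 2 := by exact_mod_cast h1
  have h4 : (√2 : ℝ) ^ 2 = 2 := Real.sq_sqrt (by norm_num)
  rw [Matrix.GeneralLinearGroup.val_det_apply, h2, Matrix.det_smul, Matrix.det_fin_two_of]
  have h5 : (2 * a * (2 * d) - b * (2 * c) : ℝ) = 2 := by linarith
  simp only [Fintype.card_fin]
  rw [h5]
  positivity

lemma IsModularWithSign.add {k : ℤ} {s : ℤˣ} {F G : ℍ → ℂ} (hF : IsModularWithSign k s F)
    (hG : IsModularWithSign k s G) : IsModularWithSign k s (F + G) where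
  invariant γ h := by rw [SlashAction.add_slash, hF.invariant γ h, hG.invariant γ h]
  sign γ h := by rw [SlashAction.add_slash, hF.sign γ h, hG.sign γ h, smul_add]
  cusps γ := by
    obtain ⟨L, hL⟩ := hF.cusps γ
    obtain ⟨M, hM⟩ := hG.cusps γ
    exact ⟨L + M, by rw [SlashAction.add_slash]; exact hL.add hM⟩

lemma IsModularWithSign.smul {k : ℤ} {s : ℤˣ} {F : ℍ → ℂ} (hF : IsModularWithSign k s F)
    (a : ℂ) : IsModularWithSign k s (a • F) where
  invariant γ h := by rw [ModularForm.SL_smul_slash, hF.invariant γ h]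
  sign γ h := by
    rw [ModularForm.smul_slash, hF.sign γ h, σ, if_pos (det_pos_of_mem h)]
    exact smul_comm _ _ _
  cusps γ := by
    obtain ⟨L, hL⟩ := hF.cusps γ
    exact ⟨a • L, by rw [ModularForm.SL_smul_slash]; exact hL.const_smul a⟩

/-- The space of quasimodular forms of weight `k` and depth at most `r` for `Γ₀⁺(2)` with
Atkin-Lehner sign `s`. -/
def quasimodularSpace (k : ℤ) (r : ℕ) (s : ℤˣ) : Submodule ℂ (ℍ → ℂ) where
  carrier := {f | IsQuasimodular k r s f}
  add_mem' := by
    rintro f g ⟨c, rfl, hc, hc'⟩ ⟨d, rfl, hd, hd'⟩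
    exact ⟨c + d, rfl, fun j hj => (hc j hj).add (hd j hj), by
      rw [nearlySum_add]; exact hc'.add hd'⟩
  zero_mem' := by
    refine ⟨0, rfl, fun j _ => mdifferentiable_const, ?_⟩
    have h0 : nearlySum r 0 = 0 := by ext z; simp [nearlySum]
    rw [h0]
    exact ⟨by simp, by simp, fun γ => ⟨0, by
      rw [SlashAction.zero_slash]; exact tendsto_const_nhds⟩⟩
  smul_mem' := by
    rintro a f ⟨c, rfl, hc, hc'⟩
    exact ⟨a • c, rfl, fun j hj => (hc j hj).const_smul a, by
      rw [nearlySum_smul]; exact hc'.smul a⟩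

/-- `f` has a Fourier expansion `∑ a_m q^m`, `q = exp(2πiz)`, on the upper half plane whose first
nonzero coefficient is `a_n`. -/
def HasVanishingOrder (f : ℍ → ℂ) (n : ℕ) : Prop :=
  ∃ a : ℕ → ℂ, (∀ z : ℍ, HasSum (fun m => a m * Function.Periodic.qParam 1 (z : ℂ) ^ m) (f z)) ∧
    (∀ m < n, a m = 0) ∧ a n ≠ 0

/-- `f` lies in the space `V` and its vanishing order at infinity equals `dim V - 1`. -/
def IsExtremal (V : Submodule ℂ (ℍ → ℂ)) (f : ℍ → ℂ) : Prop :=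
  f ∈ V ∧ ∃ n : ℕ, HasVanishingOrder f n ∧ n + 1 = Module.finrank ℂ V

/-- The point `2z` of the upper half plane. -/
def double (z : ℍ) : ℍ := ⟨2 * (z : ℂ), by simpa using z.im_pos⟩

/-- `M₂(z) = 2 E₂(2z) - E₂(z)`. -/
def M2 (z : ℍ) : ℂ := 2 * EisensteinSeries.E2 (double z) - EisensteinSeries.E2 z

/-- `M₄(z) = (4 E₄(2z) + E₄(z)) / 5`. -/
def M4 (z : ℍ) : ℂ := (4 * ModularForm.E₄ (double z) + ModularForm.E₄ z) / 5

/-- `M₈(z) = η(z)⁸ η(2z)⁸`. -/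
def M8 (z : ℍ) : ℂ := ModularForm.eta z ^ 8 * ModularForm.eta (double z) ^ 8

/-- `g` is a holomorphic branch of `M₈^{k/2}` on the upper half plane. -/
def IsM8HalfPower (k : ℕ) (g : ℍ → ℂ) : Prop := MDiff g ∧ ∀ z, g z ^ 2 = M8 z ^ k

/-- `y` is holomorphic near `z` and satisfies `y'' = -4π² Q y` at `z`. -/
def SolvesAt (Q y : ℍ → ℂ) (z : ℍ) : Prop :=
  AnalyticAt ℂ (y ∘ ofComplex) z ∧
    deriv (deriv (y ∘ ofComplex)) z = -4 * (Real.pi : ℂ) ^ 2 * Q z * y z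

end QuasiLevelTwo

end

noncomputable section

namespace QuasiLevelTwo

open Derivative

/-- `F` has normalized derivative `d` at `z`. -/
def HasD (F : ℍ → ℂ) (d : ℂ) (z : ℍ) : Prop :=
  HasDerivAt (F ∘ ofComplex) (2 * (Real.pi : ℂ) * Complex.I * d) z

/-- The constant `1 / (2πi)`. -/
def kap : ℂ := (2 * (Real.pi : ℂ) * Complex.I)⁻¹

lemma two_pi_I_mul_kap : 2 * (Real.pi : ℂ) * Complex.I * kap = 1 :=
  mul_inv_cancel₀ Complex.two_pi_I_ne_zero

lemma kap_ne_zero : kap ≠ 0 := inv_ne_zero Complex.two_pi_I_ne_zero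

lemma HasD.of_mdiff {F : ℍ → ℂ} (hF : MDiff F) (z : ℍ) : HasD F (D F z) z := by
  have h := (UpperHalfPlane.mdifferentiableAt_iff.mp (hF z)).hasDerivAt
  have h2 := two_pi_I_mul_kap
  unfold HasD normalizedDerivOfComplex
  rw [← mul_assoc]
  change HasDerivAt _ (2 * (Real.pi : ℂ) * Complex.I * kap * _) _
  rwa [h2, one_mul]

lemma HasD.eq {F : ℍ → ℂ} {d : ℂ} {z : ℍ} (h : HasD F d z) : D F z = d := by
  have h1 := HasDerivAt.deriv h
  have h2 := two_pi_I_mul_kap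
  unfold normalizedDerivOfComplex
  rw [h1, ← mul_assoc]
  change kap * _ * d = d
  rw [mul_comm kap, h2, one_mul]

lemma HasD.congr {F G : ℍ → ℂ} {d e : ℂ} {z : ℍ} (h : HasD F d z) (hFG : ∀ z, G z = F z)
    (hde : e = d) : HasD G e z := by
  rw [show G = F from funext hFG, hde]; exact h

lemma HasD.add {F G : ℍ → ℂ} {d e : ℂ} {z : ℍ} (hF : HasD F d z) (hG : HasD G e z) :
    HasD (fun z => F z + G z) (d + e) z := by
  have := HasDerivAt.add hF hG
  rw [← mul_add] at this
  exact this

lemma HasD.sub {F G : ℍ → ℂ} {d e : ℂ} {z : ℍ} (hF : HasD F d z) (hG : HasD G e z) :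
    HasD (fun z => F z - G z) (d - e) z := by
  have := HasDerivAt.sub hF hG
  rw [← mul_sub] at this
  exact this

lemma HasD.mul {F G : ℍ → ℂ} {d e : ℂ} {z : ℍ} (hF : HasD F d z) (hG : HasD G e z) :
    HasD (fun z => F z * G z) (d * G z + F z * e) z := by
  have := HasDerivAt.mul hF hG
  simp only [Function.comp_apply, ofComplex_apply] at this
  unfold HasD
  exact HasDerivAt.congr_deriv this (by ring)

lemma HasD.const (c : ℂ) (z : ℍ) : HasD (fun _ => c) 0 z := by
  unfold HasD
  rw [mul_zero]
  exact hasDerivAt_const _ _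

lemma HasD.const_mul {F : ℍ → ℂ} {d : ℂ} {z : ℍ} (c : ℂ) (hF : HasD F d z) :
    HasD (fun z => c * F z) (c * d) z :=
  ((HasD.const c z).mul hF).congr (fun _ => rfl) (by ring)

lemma HasD.pow {F : ℍ → ℂ} {d : ℂ} {z : ℍ} (hF : HasD F d z) (n : ℕ) :
    HasD (fun z => F z ^ n) (n * F z ^ (n - 1) * d) z := by
  have := HasDerivAt.pow hF n
  simp only [Function.comp_apply, ofComplex_apply] at this
  unfold HasD
  exact HasDerivAt.congr_deriv this (by ring)

lemma HasD.zpow {F : ℍ → ℂ} {d : ℂ} {z : ℍ} (hF : HasD F d z) (n : ℤ) (h0 : F z ≠ 0) :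
    HasD (fun z => F z ^ n) (n * F z ^ (n - 1) * d) z := by
  have := (hasDerivAt_zpow n (F z) (Or.inl h0)).comp_of_eq (z : ℂ) hF (by simp)
  unfold HasD
  exact HasDerivAt.congr_deriv this (by ring)

lemma HasD.div {F G : ℍ → ℂ} {d e : ℂ} {z : ℍ} (hF : HasD F d z) (hG : HasD G e z)
    (h0 : G z ≠ 0) : HasD (fun z => F z / G z) ((d * G z - F z * e) / G z ^ 2) z := by
  have := HasDerivAt.div hF hG (by simpa using h0)
  simp only [Function.comp_apply, ofComplex_apply] at this
  unfold HasD
  exact HasDerivAt.congr_deriv this (by ring)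

lemma HasD.coe (z : ℍ) : HasD (fun z => (z : ℂ)) kap z := by
  unfold HasD
  rw [two_pi_I_mul_kap]
  exact (hasDerivAt_id (z : ℂ)).congr_of_eventuallyEq (eventuallyEq_coe_comp_ofComplex z.im_pos)

lemma mdiff_of_hasD {F : ℍ → ℂ} (h : ∀ z, ∃ d, HasD F d z) : MDiff F := fun z => by
  obtain ⟨d, hd⟩ := h z
  exact UpperHalfPlane.mdifferentiableAt_iff.mpr (HasDerivAt.differentiableAt hd)

lemma mdiff_D {F : ℍ → ℂ} (hF : MDiff F) : MDiff (D F) :=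
  normalizedDerivOfComplex_mdifferentiable hF

lemma mdiff_mul {F G : ℍ → ℂ} (hF : MDiff F) (hG : MDiff G) : MDiff (fun z => F z * G z) :=
  hF.mul hG

lemma mdiff_add {F G : ℍ → ℂ} (hF : MDiff F) (hG : MDiff G) : MDiff (fun z => F z + G z) :=
  hF.add hG

lemma mdiff_sub {F G : ℍ → ℂ} (hF : MDiff F) (hG : MDiff G) : MDiff (fun z => F z - G z) :=
  hF.sub hG

lemma mdiff_const (c : ℂ) : MDiff (fun _ : ℍ => c) := mdifferentiable_const

lemma mdiff_const_mul {F : ℍ → ℂ} (c : ℂ) (hF : MDiff F) : MDiff (fun z => c * F z) :=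
  mdiff_mul (mdiff_const c) hF

lemma mdiff_pow {F : ℍ → ℂ} (hF : MDiff F) (n : ℕ) : MDiff (fun z => F z ^ n) :=
  mdiff_of_hasD fun z => ⟨_, (HasD.of_mdiff hF z).pow n⟩

lemma mdiff_div {F G : ℍ → ℂ} (hF : MDiff F) (hG : MDiff G) (h0 : ∀ z, G z ≠ 0) :
    MDiff (fun z => F z / G z) :=
  mdiff_of_hasD fun z => ⟨_, (HasD.of_mdiff hF z).div (HasD.of_mdiff hG z) (h0 z)⟩

lemma mdiff_coe : MDiff (fun z : ℍ => (z : ℂ)) := UpperHalfPlane.mdifferentiable_coe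

/-- The Fricke involution `z ↦ -1 / (2z)`. -/
def fricke (z : ℍ) : ℍ := ⟨-1 / (2 * (z : ℂ)), by
  rw [neg_div, one_div, ← inv_neg]
  rw [Complex.inv_im]
  have : (0 : ℝ) < z.im := z.im_pos
  have h2 : 0 < Complex.normSq (-(2 * (z : ℂ))) := by
    rw [Complex.normSq_pos]; simpa using z.ne_zero
  refine div_pos ?_ h2
  simp [z.im_pos]⟩

lemma coe_fricke (z : ℍ) : ((fricke z : ℍ) : ℂ) = -1 / (2 * (z : ℂ)) := rfl

/-- The translation `z ↦ z + 1`. -/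
def shift (z : ℍ) : ℍ := (1 : ℝ) +ᵥ z

lemma coe_shift (z : ℍ) : ((shift z : ℍ) : ℂ) = z + 1 := by
  simp [shift, add_comm]

lemma HasD.comp_hol {F : ℍ → ℂ} {d e : ℂ} {z : ℍ} {w : ℍ → ℍ}
    (hF : HasD F d (w z)) (hw : HasD (fun z => (w z : ℂ)) (kap * e) z) :
    HasD (fun z => F (w z)) (d * e) z := by
  unfold HasD at hw
  rw [← mul_assoc, two_pi_I_mul_kap, one_mul] at hw
  have h2 := HasDerivAt.comp_of_eq (z : ℂ) hF hw (by simp)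
  unfold HasD
  rw [← mul_assoc]
  refine h2.congr_of_eventuallyEq (Eventually.of_forall fun w => ?_)
  simp

lemma HasD.comp_fricke {F : ℍ → ℂ} {d : ℂ} {z : ℍ} (hF : HasD F d (fricke z)) :
    HasD (fun z => F (fricke z)) (d / (2 * (z : ℂ) ^ 2)) z := by
  have h0 := z.ne_zero
  refine (hF.comp_hol (e := 1 / (2 * (z : ℂ) ^ 2)) ?_).congr (fun _ => rfl) (by ring)
  refine ((HasD.const (-1) z).div ((HasD.coe z).const_mul 2) (by simpa using h0)).congr
    (fun z => coe_fricke z) ?_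
  field_simp
  ring

lemma HasD.comp_shift {F : ℍ → ℂ} {d : ℂ} {z : ℍ} (hF : HasD F d (shift z)) :
    HasD (fun z => F (shift z)) d z := by
  refine (hF.comp_hol (e := 1) ?_).congr (fun _ => rfl) (by ring)
  refine ((HasD.coe z).add (HasD.const 1 z)).congr (fun z => coe_shift z) (by ring)

lemma mdiff_comp_fricke {F : ℍ → ℂ} (hF : MDiff F) : MDiff (fun z => F (fricke z)) :=
  mdiff_of_hasD fun z => ⟨_, (HasD.of_mdiff hF (fricke z)).comp_fricke⟩

lemma mdiff_comp_shift {F : ℍ → ℂ} (hF : MDiff F) : MDiff (fun z => F (shift z)) :=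
  mdiff_of_hasD fun z => ⟨_, (HasD.of_mdiff hF (shift z)).comp_shift⟩

/-- Evaluating `D F` at a Fricke image from the transformation law of `F`. -/
lemma D_fricke {F G : ℍ → ℂ} (hF : MDiff F) (h : ∀ z, F (fricke z) = G z) {z : ℍ} {d : ℂ}
    (hG : HasD G d z) : D F (fricke z) = 2 * (z : ℂ) ^ 2 * d := by
  have h0 := z.ne_zero
  have h1 := (HasD.of_mdiff hF (fricke z)).comp_fricke.eq
  have h2 : D (fun z => F (fricke z)) z = d := (hG.congr h rfl).eq
  rw [h2] at h1
  rw [h1]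
  field_simp

lemma D_shift {F G : ℍ → ℂ} (hF : MDiff F) (h : ∀ z, F (shift z) = G z) {z : ℍ} {d : ℂ}
    (hG : HasD G d z) : D F (shift z) = d := by
  have h1 := (HasD.of_mdiff hF (shift z)).comp_shift.eq
  rw [← h1]
  exact (hG.congr h rfl).eq

lemma eq_zero_or_eq_zero_of_mul {F G : ℍ → ℂ} (hF : MDiff F) (hG : MDiff G)
    (h : ∀ z, F z * G z = 0) : (∀ z, F z = 0) ∨ (∀ z, G z = 0) := by
  rcases (UpperHalfPlane.mul_eq_zero_iff hF hG).mp (funext h) with h | h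
  · exact Or.inl (congrFun h)
  · exact Or.inr (congrFun h)

/-- Holomorphic coefficients of a function affine in `1/(z - z̄)` are determined by it. -/
lemma eq_zero_of_add_mul_im {a b : ℍ → ℂ} (ha : MDiff a) (hb : MDiff b)
    (h : ∀ z, a z * ((z : ℂ) - conj (z : ℂ)) + b z = 0) : (∀ z, a z = 0) ∧ ∀ z, b z = 0 := by
  suffices h1 : ∀ z, a z = 0 from ⟨h1, fun z => by simpa [h1 z] using h z⟩
  intro z
  have hA := HasD.of_mdiff ha z
  have hB := HasD.of_mdiff hb z
  have hc := HasDerivAt.add (HasDerivAt.mul hA (hasDerivAt_id (z : ℂ))) hB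
  set A := a ∘ ofComplex with hAdef
  set α := 2 * (Real.pi : ℂ) * Complex.I * D a z
  set β := 2 * (Real.pi : ℂ) * Complex.I * D b z
  -- differentiate along the two real directions
  have key : ∀ v : ℂ, (α * z + A z + β) * v = α * v * conj (z : ℂ) + A z * conj v := by
    intro v
    have hl : HasDerivAt (fun t : ℝ => (z : ℂ) + t * v) v 0 := by
      simpa using ((Complex.ofRealCLM.hasDerivAt (x := (0 : ℝ))).mul_const v).const_add (z : ℂ)
    have hl' : HasDerivAt (fun t : ℝ => conj ((z : ℂ) + t * v)) (conj v) 0 :=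
      (Complex.conjCLE.toContinuousLinearMap.hasFDerivAt.comp_hasDerivAt (0 : ℝ) hl)
    have e1 := HasDerivAt.comp_of_eq (0 : ℝ) hc hl (by simp)
    have e2 := (HasDerivAt.comp_of_eq (0 : ℝ) hA hl (by simp)).mul hl'
    have hev : ∀ᶠ t : ℝ in 𝓝 0, 0 < ((z : ℂ) + t * v).im := by
      have : ContinuousAt (fun t : ℝ => ((z : ℂ) + t * v).im) 0 := by fun_prop
      exact this.eventually (lt_mem_nhds (by simpa using z.im_pos))
    have e3 := e1.congr_of_eventuallyEq (f₁ := fun t : ℝ => A ((z : ℂ) + t * v) *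
        conj ((z : ℂ) + t * v)) (hev.mono fun t ht => by
      have := h ⟨_, ht⟩
      simp only [Function.comp_apply, hAdef, Pi.add_apply, Pi.mul_apply,
        ofComplex_apply_of_im_pos ht, id] at this ⊢
      linear_combination -this)
    have := e3.unique e2
    simp only [id, mul_one] at this
    simpa [α, hAdef] using this
  have k1 := key 1
  have k2 := key Complex.I
  simp only [map_one, Complex.conj_I] at k1 k2
  have : A z = 0 := by
    have h3 : 2 * Complex.I * A z = 0 := by linear_combination (Complex.I * k1 - k2) * (-1)
    simpa using h3
  simpa [hAdef] using this

/-- Two holomorphic functions with vanishing Wronskian are proportional. -/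
lemma exists_eq_mul_of_wronskian_eq_zero {X Y : ℍ → ℂ} (hX : MDiff X) (hY : MDiff Y)
    (h0 : ∃ z, X z ≠ 0) (h : ∀ z, X z * D Y z - Y z * D X z = 0) : ∃ l : ℂ, ∀ z, Y z = l * X z := by
  obtain ⟨z0, hz0⟩ := h0
  refine ⟨Y z0 / X z0, ?_⟩
  have hcont : ContinuousAt (X ∘ ofComplex) z0 := (HasDerivAt.continuousAt (HasD.of_mdiff hX z0))
  have hne : ∀ᶠ w in 𝓝 (z0 : ℂ), (X ∘ ofComplex) w ≠ 0 ∧ 0 < w.im :=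
    (hcont.eventually_ne (by simpa using hz0)).and (isOpen_upperHalfPlaneSet.mem_nhds z0.im_pos)
  obtain ⟨r, hr, hball⟩ := Metric.eventually_nhds_iff_ball.mp hne
  have hconst : ∀ w ∈ Metric.ball (z0 : ℂ) r, (Y ∘ ofComplex) w / (X ∘ ofComplex) w =
      Y z0 / X z0 := by
    intro w hw
    have := IsOpen.is_const_of_deriv_eq_zero (𝕜 := ℂ) Metric.isOpen_ball
      (convex_ball (z0 : ℂ) r).isPreconnected
      (f := fun w => (Y ∘ ofComplex) w / (X ∘ ofComplex) w) (s := Metric.ball (z0 : ℂ) r) ?_ ?_ hw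
      (Metric.mem_ball_self hr)
    · simpa using this
    · intro w hw
      obtain ⟨h1, h2⟩ := hball w hw
      have dX := HasD.of_mdiff hX ⟨w, h2⟩
      have dY := HasD.of_mdiff hY ⟨w, h2⟩
      exact ((HasDerivAt.differentiableAt dY).div (HasDerivAt.differentiableAt dX)
        h1).differentiableWithinAt
    · intro w hw
      obtain ⟨h1, h2⟩ := hball w hw
      have dX := HasD.of_mdiff hX ⟨w, h2⟩
      have dY := HasD.of_mdiff hY ⟨w, h2⟩
      have h3 := h ⟨w, h2⟩
      have := (HasDerivAt.div dY dX h1).deriv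
      refine this.trans ?_
      simp only [Function.comp_apply, ofComplex_apply_of_im_pos h2] at h1 ⊢
      simp only [Pi.zero_apply, div_eq_zero_iff]
      left
      linear_combination (2 * (Real.pi : ℂ) * Complex.I) * h3
  have hZ : (fun z => Y z - Y z0 / X z0 * X z) = 0 := by
    refine UpperHalfPlane.eq_zero_of_frequently (τ := z0)
      (mdiff_sub hY (mdiff_const_mul _ hX)) (Eventually.frequently ?_)
    refine Filter.Eventually.filter_mono nhdsWithin_le_nhds ?_
    have hc : ContinuousAt (fun z : ℍ => (z : ℂ)) z0 := UpperHalfPlane.continuous_coe.continuousAt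
    filter_upwards [hc.eventually (Metric.ball_mem_nhds (z0 : ℂ) hr)] with w hw
    have h1 := hconst w hw
    have h2 := (hball w hw).1
    simp only [Function.comp_apply, ofComplex_apply] at h1 h2
    rw [← h1]
    field_simp
    ring
  exact fun z => sub_eq_zero.mp (congrFun hZ z)

/-- The nome `q = exp(2πiz)`. -/
def nome (z : ℍ) : ℂ := Function.Periodic.qParam 1 (z : ℂ)

lemma nome_eq (z : ℍ) : nome z = Complex.exp (2 * Real.pi * Complex.I * z) := by
  simp [nome, Function.Periodic.qParam]

lemma nome_ne_zero (z : ℍ) : nome z ≠ 0 := by rw [nome_eq]; exact Complex.exp_ne_zero _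

lemma norm_nome_lt_one (z : ℍ) : ‖nome z‖ < 1 := by
  simpa [nome] using UpperHalfPlane.norm_qParam_lt_one 1 z

lemma tendsto_nome : Tendsto nome atImInfty (𝓝 0) :=
  UpperHalfPlane.qParam_tendsto_atImInfty zero_lt_one

lemma nome_shift (z : ℍ) : nome (shift z) = nome z := by
  rw [nome_eq, nome_eq, coe_shift, mul_add, Complex.exp_add]
  simp [Complex.exp_two_pi_mul_I]

lemma nome_double (z : ℍ) : nome (double z) = nome z ^ 2 := by
  rw [nome_eq, nome_eq, ← Complex.exp_nat_mul]
  congr 1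
  change 2 * Real.pi * Complex.I * (2 * (z : ℂ)) = _
  push_cast; ring

lemma coe_double (z : ℍ) : ((double z : ℍ) : ℂ) = 2 * z := rfl

/-- The Euler product `∏ (1 - q^(n+1))`. -/
def eulerProd (q : ℂ) : ℂ := ∏' n : ℕ, (1 - q ^ (n + 1))

lemma tendsto_eulerProd : Tendsto eulerProd (𝓝 0) (𝓝 1) := by
  have := tendsto_tprod_one_add_of_dominated_convergence (𝓕 := 𝓝 0) (g := 0)
    (f := fun (q : ℂ) (n : ℕ) ↦ -q ^ (n + 1)) (bound := fun n ↦ (1 / 2 : ℝ) ^ (n + 1))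
  simp only [Pi.zero_apply, norm_neg, norm_pow, add_zero, tprod_one] at this
  unfold eulerProd
  simp_rw [sub_eq_add_neg]
  refine this
    (by simpa only [pow_succ'] using (summable_geometric_of_abs_lt_one (by norm_num)).mul_left _)
    (fun k ↦ by simpa using ((continuous_pow (M := ℂ) (k + 1)).tendsto 0).neg) ?_
  filter_upwards [Metric.ball_mem_nhds (0 : ℂ) (by norm_num : (0 : ℝ) < 1 / 2)] with q hq k
  exact pow_le_pow_left₀ (norm_nonneg _) (mem_ball_zero_iff.mp hq).le _

lemma eta_eq (z : ℍ) : ModularForm.eta z = Function.Periodic.qParam 24 (z : ℂ) *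
    eulerProd (nome z) := by
  simp only [ModularForm.eta, eulerProd, ModularForm.eta_q_eq_pow, nome_eq]

/-- The factor `M₈ / q`. -/
def M8unit (z : ℍ) : ℂ := eulerProd (nome z) ^ 8 * eulerProd (nome z ^ 2) ^ 8

lemma M8_eq_nome_mul (z : ℍ) : M8 z = nome z * M8unit z := by
  have h : Function.Periodic.qParam 24 (z : ℂ) ^ 8 *
      Function.Periodic.qParam 24 ((double z : ℍ) : ℂ) ^ 8 = nome z := by
    rw [nome_eq, coe_double]
    simp only [Function.Periodic.qParam]
    rw [← Complex.exp_nat_mul, ← Complex.exp_nat_mul, ← Complex.exp_add]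
    congr 1
    push_cast
    ring
  rw [M8, eta_eq, eta_eq, nome_double, M8unit, ← h]
  ring

lemma tendsto_M8unit : Tendsto M8unit atImInfty (𝓝 1) := by
  have h1 := tendsto_eulerProd.comp tendsto_nome
  have h2 : Tendsto (fun z => nome z ^ 2) atImInfty (𝓝 0) := by
    simpa using tendsto_nome.pow 2
  have h3 := tendsto_eulerProd.comp h2
  have := (h1.pow 8).mul (h3.pow 8)
  rw [one_pow, one_mul] at this
  exact this

lemma tendsto_M8 : Tendsto M8 atImInfty (𝓝 0) := by
  have := tendsto_nome.mul tendsto_M8unit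
  rw [zero_mul] at this
  exact this.congr fun z => (M8_eq_nome_mul z).symm

lemma M8_ne_zero (z : ℍ) : M8 z ≠ 0 :=
  mul_ne_zero (pow_ne_zero _ (ModularForm.eta_ne_zero z.2))
    (pow_ne_zero _ (ModularForm.eta_ne_zero (double z).2))

lemma M8unit_ne_zero (z : ℍ) : M8unit z ≠ 0 := fun h =>
  M8_ne_zero z (by rw [M8_eq_nome_mul, h, mul_zero])

lemma M8_shift (z : ℍ) : M8 (shift z) = M8 z := by
  simp only [M8_eq_nome_mul, M8unit, nome_shift]

lemma csqrt_pow_eight (z : ℂ) : Complex.sqrt z ^ 8 = z ^ 4 := by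
  have h : Complex.sqrt z ^ 2 = z := by simp [Complex.sqrt]
  rw [show (8 : ℕ) = 2 * 4 by norm_num, pow_mul, h]

lemma eta_neg_inv_pow_eight (z : ℍ) :
    ModularForm.eta (-1 / (z : ℂ)) ^ 8 = (z : ℂ) ^ 4 * ModularForm.eta z ^ 8 := by
  have h := ModularForm.eta_comp_eq_csqrt_I_inv z.2
  simp only [Function.comp_apply, Pi.smul_apply, Pi.mul_apply, smul_eq_mul] at h
  rw [h, mul_pow, mul_pow, inv_pow, csqrt_pow_eight, csqrt_pow_eight,
    Complex.I_pow_four]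
  simp

lemma double_fricke (z : ℍ) : ((double (fricke z) : ℍ) : ℂ) = -1 / z := by
  rw [coe_double, coe_fricke]
  have := z.ne_zero
  field_simp

lemma M8_fricke (z : ℍ) : M8 (fricke z) = 16 * (z : ℂ) ^ 8 * M8 z := by
  have h1 := eta_neg_inv_pow_eight z
  have h2 := eta_neg_inv_pow_eight (double z)
  rw [coe_double] at h2
  rw [M8, double_fricke, coe_fricke, h1, h2, M8, coe_double]
  ring

/-- The logarithmic derivative of `M₈`. -/
def P2 (z : ℍ) : ℂ := (EisensteinSeries.E2 z + 2 * EisensteinSeries.E2 (double z)) / 3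

lemma hasDerivAt_eta (z : ℍ) : HasDerivAt ModularForm.eta
    ((Real.pi * Complex.I / 12) * EisensteinSeries.E2 z * ModularForm.eta z) z := by
  have h := ModularForm.logDeriv_eta_eq_E2 z
  have h0 := ModularForm.eta_ne_zero z.2
  have hd := (ModularForm.differentiableAt_eta_of_mem_upperHalfPlaneSet z.2).hasDerivAt
  rw [logDeriv_apply, div_eq_iff h0] at h
  rwa [h] at hd

lemma HasD.comp_double {F : ℍ → ℂ} {d : ℂ} {z : ℍ} (hF : HasD F d (double z)) :
    HasD (fun z => F (double z)) (2 * d) z := by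
  refine (hF.comp_hol (e := 2) ?_).congr (fun _ => rfl) (by ring)
  exact ((HasD.coe z).const_mul 2).congr (fun z => coe_double z) (by ring)

lemma mdiff_comp_double {F : ℍ → ℂ} (hF : MDiff F) : MDiff (fun z => F (double z)) :=
  mdiff_of_hasD fun z => ⟨_, (HasD.of_mdiff hF (double z)).comp_double⟩

lemma hasD_eta (z : ℍ) : HasD (fun z => ModularForm.eta z)
    (EisensteinSeries.E2 z * ModularForm.eta z / 24) z := by
  unfold HasD
  refine HasDerivAt.congr_deriv ((hasDerivAt_eta z).congr_of_eventuallyEq ?_) (by ring)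
  filter_upwards [eventuallyEq_coe_comp_ofComplex z.im_pos] with w hw
  simp only [Function.comp_apply] at hw ⊢
  rw [hw]
  rfl

lemma hasD_M8 (z : ℍ) : HasD M8 (P2 z * M8 z) z := by
  have h1 := (hasD_eta z).pow 8
  have h2 := ((hasD_eta (double z)).comp_double).pow 8
  refine (h1.mul h2).congr (fun z => rfl) ?_
  rw [P2, M8]
  push_cast
  ring

lemma mdiff_M8 : MDiff M8 := mdiff_of_hasD fun z => ⟨_, hasD_M8 z⟩

lemma mdiff_E2 : MDiff EisensteinSeries.E2 := E2_mdifferentiable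

lemma mdiff_P2 : MDiff P2 :=
  mdiff_div (mdiff_add mdiff_E2 (mdiff_const_mul 2 (mdiff_comp_double mdiff_E2)))
    (mdiff_const 3) (by norm_num)

lemma mdiff_M2 : MDiff M2 :=
  mdiff_sub (mdiff_const_mul 2 (mdiff_comp_double mdiff_E2)) mdiff_E2

/-- A holomorphic function of period one which is bounded at `i∞`. -/
structure Regular (F : ℍ → ℂ) : Prop where
  hol : MDiff F
  per : ∀ z, F (shift z) = F z
  bdd : IsBoundedAtImInfty F

namespace Regular

variable {F G : ℍ → ℂ}

lemma mul (hF : Regular F) (hG : Regular G) : Regular (fun z => F z * G z) :=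
  ⟨mdiff_mul hF.hol hG.hol, fun z => by rw [hF.per, hG.per], hF.bdd.mul hG.bdd⟩

lemma add (hF : Regular F) (hG : Regular G) : Regular (fun z => F z + G z) :=
  ⟨mdiff_add hF.hol hG.hol, fun z => by rw [hF.per, hG.per], hF.bdd.add hG.bdd⟩

lemma const (c : ℂ) : Regular (fun _ => c) :=
  ⟨mdiff_const c, fun _ => rfl, Filter.const_boundedAtFilter _ c⟩

lemma const_mul (c : ℂ) (hF : Regular F) : Regular (fun z => c * F z) := (const c).mul hF

lemma sub (hF : Regular F) (hG : Regular G) : Regular (fun z => F z - G z) := by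
  simpa [sub_eq_add_neg] using hF.add (hG.const_mul (-1))

lemma pow (hF : Regular F) (n : ℕ) : Regular (fun z => F z ^ n) := by
  induction n with
  | zero => simpa using const 1
  | succ n ih => simpa [pow_succ] using ih.mul hF

lemma periodic (hF : Regular F) : Function.Periodic (F ∘ ofComplex) ((1 : ℝ) : ℂ) := by
  intro w
  by_cases hw : 0 < w.im
  · have hw' : 0 < (w + ((1 : ℝ) : ℂ)).im := by simpa using hw
    simp only [Function.comp_apply, ofComplex_apply_of_im_pos hw, ofComplex_apply_of_im_pos hw']
    rw [← hF.per ⟨w, hw⟩]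
    congr 1
    ext
    rw [coe_shift]
    simp
  · have hw' : ¬ 0 < (w + ((1 : ℝ) : ℂ)).im := by simpa using hw
    simp only [Function.comp_apply]
    rw [ofComplex_apply_of_im_nonpos (not_lt.mp hw), ofComplex_apply_of_im_nonpos (not_lt.mp hw')]

/-- A regular function is an analytic function of the nome. -/
lemma exists_analyticAt (hF : Regular F) : ∃ φ : ℂ → ℂ, AnalyticAt ℂ φ 0 ∧
    (∀ z, F z = φ (nome z)) ∧ ∀ z, DifferentiableAt ℂ φ (nome z) :=
  ⟨cuspFunction 1 F, analyticAt_cuspFunction_zero zero_lt_one hF.periodic hF.hol hF.bdd,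
    fun z => (eq_cuspFunction z one_ne_zero hF.periodic).symm,
    fun z => differentiableAt_cuspFunction zero_lt_one hF.periodic hF.hol hF.bdd
      (norm_nome_lt_one z)⟩

lemma exists_tendsto (hF : Regular F) : ∃ L, Tendsto F atImInfty (𝓝 L) := by
  obtain ⟨φ, h1, h2, -⟩ := hF.exists_analyticAt
  exact ⟨φ 0, (h1.continuousAt.tendsto.comp tendsto_nome).congr fun z => (h2 z).symm⟩

lemma tendsto_D (hF : Regular F) : Tendsto (D F) atImInfty (𝓝 0) := by
  obtain ⟨φ, h1, h2, h3⟩ := hF.exists_analyticAt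
  have h4 : ∀ z, D F z = nome z * deriv φ (nome z) := by
    intro z
    refine HasD.eq ?_
    have hq : HasDerivAt (fun w : ℂ => Complex.exp (2 * Real.pi * Complex.I * w))
        (2 * Real.pi * Complex.I * nome z) (z : ℂ) := by
      have := ((hasDerivAt_id (z : ℂ)).const_mul (2 * Real.pi * Complex.I)).cexp
      rw [nome_eq]
      exact HasDerivAt.congr_deriv this (by simp; ring)
    have := (h3 z).hasDerivAt.comp_of_eq (z : ℂ) hq (nome_eq z)
    unfold HasD
    refine (HasDerivAt.congr_deriv this (by ring)).congr_of_eventuallyEq ?_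
    filter_upwards [isOpen_upperHalfPlaneSet.mem_nhds z.im_pos] with w hw
    simp [ofComplex_apply_of_im_pos hw, h2, nome_eq]
  have h5 := tendsto_nome.mul (h1.deriv.continuousAt.tendsto.comp tendsto_nome)
  rw [zero_mul] at h5
  exact h5.congr fun z => (h4 z).symm

lemma normalizedDeriv (hF : Regular F) : Regular (D F) :=
  ⟨mdiff_D hF.hol, fun z => D_shift hF.hol hF.per (HasD.of_mdiff hF.hol z),
    hF.tendsto_D.isBigO_one ℝ⟩

lemma div_M8 (hF : Regular F) (h0 : Tendsto F atImInfty (𝓝 0)) :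
    Regular (fun z => F z / M8 z) := by
  refine ⟨mdiff_div hF.hol mdiff_M8 M8_ne_zero, fun z => by rw [hF.per, M8_shift], ?_⟩
  obtain ⟨φ, h1, h2, -⟩ := hF.exists_analyticAt
  have hφ : φ 0 = 0 := tendsto_nhds_unique
    ((h1.continuousAt.tendsto.comp tendsto_nome).congr fun z => (h2 z).symm) h0
  have hs := (hasDerivAt_iff_tendsto_slope.mp h1.differentiableAt.hasDerivAt).comp
    (tendsto_nhdsWithin_iff.mpr ⟨tendsto_nome, Eventually.of_forall nome_ne_zero⟩)
  have := hs.div tendsto_M8unit one_ne_zero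
  refine (this.congr fun z => ?_).isBigO_one ℝ
  rw [h2, M8_eq_nome_mul, ← div_div]
  simp [slope_def_field, hφ]

end Regular

lemma regular_M8 : Regular M8 := ⟨mdiff_M8, M8_shift, tendsto_M8.isBigO_one ℝ⟩

/-- A function with a `q`-expansion starting in degree `k` is divisible by `M₈ ^ k`. -/
lemma regular_div_M8_pow {F : ℍ → ℂ} (hF : MDiff F) {a : ℕ → ℂ}
    (ha : ∀ z : ℍ, HasSum (fun m => a m * nome z ^ m) (F z)) {k : ℕ} (hk : ∀ m < k, a m = 0) :
    Regular (fun z => F z / M8 z ^ k) ∧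
      Tendsto (fun z => F z / M8 z ^ k) atImInfty (𝓝 (a k)) := by
  have hsh : ∀ (b : ℕ → ℂ) (G : ℍ → ℂ), (∀ z : ℍ, HasSum (fun m => b m * nome z ^ m) (G z)) →
      ∀ n, (∀ m < n, b m = 0) →
      ∀ z, HasSum (fun m => b (m + n) * nome z ^ m) (G z / nome z ^ n) := by
    intro b G hb n hn z
    have h := (hasSum_nat_add_iff' n).mpr (hb z)
    rw [Finset.sum_eq_zero (fun m hm => by rw [hn m (Finset.mem_range.mp hm), zero_mul]),
      sub_zero] at h
    refine (h.div_const (nome z ^ n)).congr_fun ?_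
    intro m
    have := nome_ne_zero z
    rw [pow_add]; field_simp
  have hbd : ∀ (b : ℕ → ℂ) (G : ℍ → ℂ), (∀ z : ℍ, HasSum (fun m => b m * nome z ^ m) (G z)) →
      IsBoundedAtImInfty G := fun b G hb =>
    isBoundedAtImInfty_of_hasSum_qExpansion (h := 1) (c := b) one_pos fun z => by
      simpa [smul_eq_mul, nome] using hb z
  have h1 := hsh a F ha k hk
  have h2 : ∀ z : ℍ, HasSum (fun m => (if m = 0 then 0 else a (m + k)) * nome z ^ m)
      (F z / nome z ^ k - a k) := by
    intro z
    have := (h1 z).sub (hasSum_ite_eq 0 (a k))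
    refine this.congr_fun ?_
    intro m
    by_cases hm : m = 0 <;> simp [hm]
  have h3 := hbd _ _ (hsh _ _ h2 1 (by intro m hm; simp [Nat.lt_one_iff.mp hm]))
  have h4 : Tendsto (fun z => F z / nome z ^ k) atImInfty (𝓝 (a k)) := by
    have h5 : Tendsto (fun z => (F z / nome z ^ k - a k) / nome z ^ 1 * nome z)
        atImInfty (𝓝 0) := by
      have := Asymptotics.IsBigO.mul_isLittleO h3
        ((Asymptotics.isLittleO_one_iff ℝ).mpr tendsto_nome)
      rw [← Asymptotics.isLittleO_one_iff ℝ]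
      simpa using this
    have h6 := h5.add_const (a k)
    rw [zero_add] at h6
    refine h6.congr fun z => ?_
    have := nome_ne_zero z
    field_simp
    ring
  have h7 : Tendsto (fun z => F z / M8 z ^ k) atImInfty (𝓝 (a k)) := by
    have := h4.div (tendsto_M8unit.pow k) (by simp)
    simp only [one_pow, div_one] at this
    refine this.congr fun z => ?_
    rw [M8_eq_nome_mul, mul_pow]
    simp [div_div]
  refine ⟨⟨mdiff_div hF (mdiff_pow mdiff_M8 k) fun z => pow_ne_zero _ (M8_ne_zero z), ?_,
    h7.isBigO_one ℝ⟩, h7⟩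
  intro z
  have := ha (shift z)
  rw [nome_shift] at this
  rw [(ha z).unique this, M8_shift]

lemma modular_T_smul_eq_shift (z : ℍ) : ModularGroup.T • z = shift z :=
  UpperHalfPlane.modular_T_smul z

lemma coe_modular_S_smul (z : ℍ) : ((ModularGroup.S • z : ℍ) : ℂ) = -1 / z := by
  rw [UpperHalfPlane.modular_S_smul, UpperHalfPlane.coe_mk, neg_div, one_div, inv_neg]

lemma fricke_eq (z : ℍ) : fricke z = ModularGroup.S • double z := by
  ext; rw [coe_fricke, coe_modular_S_smul, coe_double]

lemma double_fricke_eq (z : ℍ) : double (fricke z) = ModularGroup.S • z := by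
  ext; rw [double_fricke, coe_modular_S_smul]

/-- The point `z / 2`. -/
def half (z : ℍ) : ℍ := ⟨(z : ℂ) / 2, by simpa using z.im_pos⟩

lemma coe_half (z : ℍ) : ((half z : ℍ) : ℂ) = z / 2 := rfl

lemma mdiff_comp_half {F : ℍ → ℂ} (hF : MDiff F) : MDiff (fun z => F (half z)) :=
  mdiff_of_hasD fun z => ⟨_, (HasD.of_mdiff hF (half z)).comp_hol (e := 1 / 2)
    (((HasD.coe z).const_mul (1 / 2)).congr (fun z => by rw [coe_half]; ring) (by ring))⟩

lemma isBoundedAtImInfty_comp_half {F : ℍ → ℂ} (h : IsBoundedAtImInfty F) :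
    IsBoundedAtImInfty (fun z => F (half z)) := by
  rw [isBoundedAtImInfty_iff] at h ⊢
  obtain ⟨M, A, hA⟩ := h
  refine ⟨M, 2 * A, fun z hz => hA _ ?_⟩
  have : (half z).im = z.im / 2 := by
    change ((z : ℂ) / 2).im = _
    simp
  rw [this]; linarith

lemma isBoundedAtImInfty_comp_shift {F : ℍ → ℂ} (h : IsBoundedAtImInfty F) :
    IsBoundedAtImInfty (fun z => F (shift z)) := by
  rw [isBoundedAtImInfty_iff] at h ⊢
  obtain ⟨M, A, hA⟩ := h
  refine ⟨M, A, fun z hz => hA _ ?_⟩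
  rw [shift, vadd_im]; exact hz

/-- A level one invariant holomorphic function bounded at `i∞` is constant. -/
lemma exists_const_of_levelOne {N : ℍ → ℂ} (hN : MDiff N) (hb : IsBoundedAtImInfty N)
    (hT : ∀ z, N (shift z) = N z) (hS : ∀ z : ℍ, N (ModularGroup.S • z) = N z) :
    ∃ c, ∀ z, N z = c := by
  have h : ∀ γ : SL(2, ℤ), N ∣[(0 : ℤ)] γ = N :=
    SlashInvariantForm.slash_action_generators_SL2Z
      (by ext z; rw [ModularForm.SL_slash_apply, hS]; simp)
      (by ext z; rw [ModularForm.SL_slash_apply, modular_T_smul_eq_shift, hT]; simp)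
  let f : ModularForm 𝒮ℒ 0 :=
    { toFun := N
      slash_action_eq' := by rintro _ ⟨A, rfl⟩; exact h A
      holo' := hN
      bdd_at_cusps' := by
        intro c hc
        rw [Subgroup.IsArithmetic.isCusp_iff_isCusp_SL2Z] at hc
        rw [OnePoint.isBoundedAt_iff_forall_SL2Z hc]
        intro γ _
        rw [h]
        exact hb }
  obtain ⟨c, hc⟩ := ModularFormClass.levelOne_weight_zero_const f
  exact ⟨c, fun z => congrFun hc z⟩

/-- A holomorphic function invariant under `z ↦ z + 1` and the Fricke involution, and bounded at
`i∞`, is constant. -/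
lemma exists_const_of_invariant {G : ℍ → ℂ} (hG : Regular G) (hW : ∀ z, G (fricke z) = G z) :
    ∃ c, ∀ z, G z = c := by
  obtain ⟨H, hHdef⟩ : ∃ H : ℍ → ℂ, H = fun z => G z - G UpperHalfPlane.I := ⟨_, rfl⟩
  have hH : Regular H := hHdef ▸ hG.sub (Regular.const _)
  have hHW : ∀ z, H (fricke z) = H z := fun z => by simp [hHdef, hW]
  have hH0 : H UpperHalfPlane.I = 0 := by simp [hHdef]
  have hhs := mdiff_comp_shift (mdiff_comp_half hH.hol)
  have hN := exists_const_of_levelOne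
    (N := fun z => H z * (H (half z) * H (half (shift z))))
    (mdiff_mul hH.hol (mdiff_mul (mdiff_comp_half hH.hol) hhs))
    (hH.bdd.mul ((isBoundedAtImInfty_comp_half hH.bdd).mul
      (isBoundedAtImInfty_comp_shift (isBoundedAtImInfty_comp_half hH.bdd)))) ?_ ?_
  · obtain ⟨c, hc⟩ := hN
    have hc0 : c = 0 := by rw [← hc UpperHalfPlane.I, hH0, zero_mul]
    subst hc0
    have h0 : ∀ z, H z = 0 := by
      rcases eq_zero_or_eq_zero_of_mul hH.hol (mdiff_mul (mdiff_comp_half hH.hol) hhs) hc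
        with h | h
      · exact h
      · have hd : ∀ z, half (double z) = z := fun z => by ext; rw [coe_half, coe_double]; ring
        rcases eq_zero_or_eq_zero_of_mul (mdiff_comp_half hH.hol) hhs h with h | h
        · exact fun z => by simpa [hd] using h (double z)
        · intro z
          have := h ((-1 : ℝ) +ᵥ double z)
          have e : shift ((-1 : ℝ) +ᵥ double z) = double z := by
            ext; rw [coe_shift, coe_vadd]; push_cast; ring
          rwa [e, hd] at this
    exact ⟨G UpperHalfPlane.I, fun z => by simpa [hHdef, sub_eq_zero] using h0 z⟩
  · intro z
    have e : half (shift (shift z)) = shift (half z) := by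
      ext; rw [coe_half, coe_shift, coe_shift, coe_shift, coe_half]; ring
    rw [e, hH.per, hH.per]
    ring
  · intro z
    have h0 := z.ne_zero
    have e1 : ModularGroup.S • z = fricke (half z) := by
      ext; rw [coe_modular_S_smul, coe_fricke, coe_half]; field_simp
    have e2 : half (ModularGroup.S • z) = fricke z := by
      ext; rw [coe_half, coe_modular_S_smul, coe_fricke]; field_simp
    let u : ℍ := (-1 : ℝ) +ᵥ half (shift z)
    let w : ℍ := (-1 : ℝ) +ᵥ fricke u
    have hu : shift u = half (shift z) := by
      ext; rw [coe_shift, coe_vadd]; push_cast; ring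
    have hw : shift w = fricke u := by
      ext; rw [coe_shift, coe_vadd]; push_cast; ring
    have e3 : half (shift (ModularGroup.S • z)) = fricke w := by
      have hw0 := w.ne_zero
      have hu0 := u.ne_zero
      have hwc : (w : ℂ) = -1 / (2 * u) - 1 := by
        rw [← coe_fricke, ← hw, coe_shift]; ring
      have huc : (u : ℂ) = (z - 1) / 2 := by
        have := congrArg (fun z : ℍ => (z : ℂ)) hu
        simp only [coe_shift, coe_half] at this
        linear_combination this
      have hz1 : (z : ℂ) - 1 ≠ 0 := fun h => hu0 (by rw [huc, h, zero_div])
      ext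
      rw [coe_half, coe_shift, coe_modular_S_smul, coe_fricke, eq_div_iff (by simpa using hw0)]
      rw [hwc, huc]
      field_simp
      ring
    rw [e2, hHW, e3, hHW, ← hH.per w, hw, hHW, ← hH.per u, hu, e1, hHW]
    ring

lemma eq_zero_of_weight_four {G : ℍ → ℂ} (hG : Regular G)
    (hW : ∀ z, G (fricke z) = 4 * (z : ℂ) ^ 4 * G z) (h0 : Tendsto G atImInfty (𝓝 0)) :
    ∀ z, G z = 0 := by
  have h1 := hG.mul (hG.div_M8 h0)
  obtain ⟨c, hc⟩ := exists_const_of_invariant h1 fun z => by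
    rw [hW, M8_fricke]
    have := M8_ne_zero z
    have := z.ne_zero
    field_simp
    ring
  have h2 : Tendsto (fun z => G z * (G z / M8 z)) atImInfty (𝓝 0) := by
    obtain ⟨L, hL⟩ := (hG.div_M8 h0).exists_tendsto
    simpa using h0.mul hL
  have hc0 : c = 0 := tendsto_nhds_unique (tendsto_const_nhds.congr fun z => (hc z).symm) h2
  intro z
  have := hc z
  rw [hc0] at this
  have h8 := M8_ne_zero z
  simpa [h8] using this

lemma exists_eq_mul_M8_of_weight_eight {G : ℍ → ℂ} (hG : Regular G)
    (hW : ∀ z, G (fricke z) = 16 * (z : ℂ) ^ 8 * G z) (h0 : Tendsto G atImInfty (𝓝 0)) :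
    ∃ β, ∀ z, G z = β * M8 z := by
  obtain ⟨c, hc⟩ := exists_const_of_invariant (hG.div_M8 h0) fun z => by
    rw [hW, M8_fricke]
    have := M8_ne_zero z
    have := z.ne_zero
    field_simp
  exact ⟨c, fun z => by rw [← hc z, div_mul_cancel₀ _ (M8_ne_zero z)]⟩

/-! ### Eisenstein series -/

lemma E2_slash_apply (γ : SL(2, ℤ)) (z : ℍ) :
    EisensteinSeries.E2 (γ • z) = ((γ 1 0 : ℂ) * z + γ 1 1) ^ 2 * EisensteinSeries.E2 z
      + 12 * kap * (γ 1 0) * ((γ 1 0 : ℂ) * z + γ 1 1) := by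
  have h := congrFun (EisensteinSeries.E2_slash_action γ) z
  rw [ModularForm.SL_slash_apply] at h
  have hd := denom_ne_zero γ z
  simp only [Pi.sub_apply, Pi.smul_apply, smul_eq_mul, EisensteinSeries.D2, riemannZeta_two] at h
  rw [← ModularGroup.denom_apply]
  have h2 : EisensteinSeries.E2 (γ • z) = denom γ z ^ 2 * (EisensteinSeries.E2 z -
    1 / (2 * (Real.pi ^ 2 / 6)) * (2 * Real.pi * Complex.I * (γ 1 0) / denom γ z)) := by
    rw [← h, zpow_neg]
    field_simp
  rw [h2, kap]
  have hpi : (Real.pi : ℂ) ≠ 0 := by exact_mod_cast Real.pi_ne_zero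
  have hI := Complex.I_sq
  field_simp
  linear_combination (-12 * (γ 1 0 : ℂ)) * hI

lemma E2_S (z : ℍ) : EisensteinSeries.E2 (ModularGroup.S • z) =
    (z : ℂ) ^ 2 * EisensteinSeries.E2 z + 12 * kap * z := by
  rw [E2_slash_apply]
  simp [ModularGroup.S]

lemma M2_fricke (z : ℍ) : M2 (fricke z) = -(2 * (z : ℂ) ^ 2) * M2 z := by
  rw [M2, double_fricke_eq, fricke_eq, E2_S, E2_S, coe_double, M2]
  ring

lemma P2_fricke (z : ℍ) : P2 (fricke z) = 2 * (z : ℂ) ^ 2 * P2 z + 16 * kap * z := by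
  rw [P2, double_fricke_eq, fricke_eq, E2_S, E2_S, coe_double, P2]
  ring

lemma E2_shift (z : ℍ) : EisensteinSeries.E2 (shift z) = EisensteinSeries.E2 z := by
  rw [← modular_T_smul_eq_shift, E2_slash_apply]
  simp [ModularGroup.T]

lemma double_shift (z : ℍ) : double (shift z) = shift (shift (double z)) := by
  ext; rw [coe_double, coe_shift, coe_shift, coe_shift, coe_double]; ring

lemma tendsto_double : Tendsto double atImInfty atImInfty := by
  rw [atImInfty, tendsto_comap_iff]
  have h : Tendsto (fun z : ℍ => 2 * z.im) (comap UpperHalfPlane.im atTop) atTop :=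
    tendsto_comap.const_mul_atTop two_pos
  refine h.congr fun z => ?_
  change 2 * z.im = (2 * (z : ℂ)).im
  simp

lemma regular_E2 : Regular EisensteinSeries.E2 :=
  ⟨mdiff_E2, E2_shift, EisensteinSeries.isBoundedAtImInfty_E2⟩

lemma Regular.comp_double {F : ℍ → ℂ} (hF : Regular F) : Regular (fun z => F (double z)) :=
  ⟨mdiff_comp_double hF.hol, fun z => by rw [double_shift, hF.per, hF.per],
    hF.bdd.comp_tendsto tendsto_double⟩

lemma regular_M2 : Regular M2 := (regular_E2.comp_double.const_mul 2).sub regular_E2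

lemma regular_P2 : Regular P2 := by
  have := (regular_E2.add (regular_E2.comp_double.const_mul 2)).const_mul (1 / 3)
  convert this using 2
  rw [P2]; ring

lemma hasSum_E2 (z : ℍ) : HasSum (fun m : ℕ =>
    (if m = 0 then 1 else -24 * (ArithmeticFunction.sigma 1 m : ℂ)) * nome z ^ m)
    (EisensteinSeries.E2 z) := by
  simpa [smul_eq_mul, nome_eq] using EisensteinSeries.hasSum_qExpansion_E2 (z := z)

lemma tendsto_E2 : Tendsto EisensteinSeries.E2 atImInfty (𝓝 1) := by
  simpa using (regular_div_M8_pow mdiff_E2 hasSum_E2 (k := 0) (by simp)).2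

lemma tendsto_E2_sub_one_div : Tendsto (fun z => (EisensteinSeries.E2 z - 1) / M8 z)
    atImInfty (𝓝 (-24)) := by
  have h : ∀ z : ℍ, HasSum (fun m : ℕ =>
      (if m = 0 then 0 else -24 * (ArithmeticFunction.sigma 1 m : ℂ)) * nome z ^ m)
      (EisensteinSeries.E2 z - 1) := by
    intro z
    refine ((hasSum_E2 z).sub (hasSum_ite_eq 0 1)).congr_fun ?_
    intro m
    by_cases hm : m = 0 <;> simp [hm]
  simpa using (regular_div_M8_pow (mdiff_sub mdiff_E2 (mdiff_const 1)) h (k := 1)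
    (by intro m hm; simp [Nat.lt_one_iff.mp hm])).2

lemma tendsto_E2_double_sub_one_div :
    Tendsto (fun z => (EisensteinSeries.E2 (double z) - 1) / M8 z) atImInfty (𝓝 0) := by
  have h1 := tendsto_E2_sub_one_div.comp tendsto_double
  have h2 := ((tendsto_nome.mul (tendsto_M8unit.comp tendsto_double)).div tendsto_M8unit
    one_ne_zero)
  have h3 := h1.mul h2
  simp only [zero_mul, zero_div, mul_zero] at h3
  refine h3.congr fun z => ?_
  have e1 : M8 (double z) = nome z ^ 2 * M8unit (double z) := by
    rw [M8_eq_nome_mul, nome_double]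
  have h4 := M8unit_ne_zero z
  have h5 := M8unit_ne_zero (double z)
  have h6 := nome_ne_zero z
  simp only [Function.comp_apply, Pi.div_apply]
  rw [e1, M8_eq_nome_mul]
  field_simp

lemma tendsto_M2_sub_one_div : Tendsto (fun z => (M2 z - 1) / M8 z) atImInfty (𝓝 24) := by
  have := (tendsto_E2_double_sub_one_div.const_mul 2).sub tendsto_E2_sub_one_div
  norm_num at this
  refine this.congr fun z => ?_
  rw [M2]; ring

lemma tendsto_P2_sub_one_div : Tendsto (fun z => (P2 z - 1) / M8 z) atImInfty (𝓝 (-8)) := by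
  have := ((tendsto_E2_double_sub_one_div.const_mul 2).add tendsto_E2_sub_one_div).const_mul (1 / 3)
  norm_num at this
  refine this.congr fun z => ?_
  rw [P2]; ring

lemma tendsto_of_tendsto_sub_one_div {F : ℍ → ℂ} {L : ℂ}
    (h : Tendsto (fun z => (F z - 1) / M8 z) atImInfty (𝓝 L)) : Tendsto F atImInfty (𝓝 1) := by
  have := (h.mul tendsto_M8).add_const 1
  rw [mul_zero, zero_add] at this
  refine this.congr fun z => ?_
  rw [div_mul_cancel₀ _ (M8_ne_zero z)]; ring

lemma tendsto_M2 : Tendsto M2 atImInfty (𝓝 1) :=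
  tendsto_of_tendsto_sub_one_div tendsto_M2_sub_one_div

lemma tendsto_P2 : Tendsto P2 atImInfty (𝓝 1) :=
  tendsto_of_tendsto_sub_one_div tendsto_P2_sub_one_div

lemma E4_slash_apply (γ : SL(2, ℤ)) (z : ℍ) :
    ModularForm.E₄ (γ • z) = ((γ 1 0 : ℂ) * z + γ 1 1) ^ 4 * ModularForm.E₄ z := by
  have h := congrFun (ModularForm.E₄.slash_action_eq' γ ⟨γ, rfl⟩) z
  have h' : ((ModularForm.E₄ : ℍ → ℂ) ∣[(4 : ℤ)] γ) z = ModularForm.E₄ z := h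
  rw [ModularForm.SL_slash_apply] at h'
  have hd := denom_ne_zero γ z
  rw [← h', ← ModularGroup.denom_apply, zpow_neg]
  field_simp

lemma E4_S (z : ℍ) : ModularForm.E₄ (ModularGroup.S • z) = (z : ℂ) ^ 4 * ModularForm.E₄ z := by
  rw [E4_slash_apply]
  simp [ModularGroup.S]

lemma hasSum_E4 (z : ℍ) : HasSum (fun m : ℕ =>
    (qExpansion 1 ModularForm.E₄).coeff m * nome z ^ m) (ModularForm.E₄ z) :=
  ModularForm.hasSum_qExpansion ModularForm.E₄ one_pos one_mem_strictPeriods_SL z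

lemma regular_E4 : Regular ModularForm.E₄ := by
  simpa using (regular_div_M8_pow ModularForm.E₄.holo' hasSum_E4 (k := 0) (by simp)).1

lemma tendsto_E4 : Tendsto ModularForm.E₄ atImInfty (𝓝 1) := by
  have := (regular_div_M8_pow ModularForm.E₄.holo' hasSum_E4 (k := 0) (by simp)).2
  rw [EisensteinSeries.E_qExpansion_coeff_zero (by norm_num) (by decide)] at this
  simpa using this

/-- The weight four form `(4 E₄(2z) - E₄(z)) / 3` with Atkin-Lehner sign `-1`. -/
def N4 (z : ℍ) : ℂ := (4 * ModularForm.E₄ (double z) - ModularForm.E₄ z) / 3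

lemma M4_fricke (z : ℍ) : M4 (fricke z) = 4 * (z : ℂ) ^ 4 * M4 z := by
  rw [M4, double_fricke_eq, fricke_eq, E4_S, E4_S, coe_double, M4]
  ring

lemma N4_fricke (z : ℍ) : N4 (fricke z) = -(4 * (z : ℂ) ^ 4) * N4 z := by
  rw [N4, double_fricke_eq, fricke_eq, E4_S, E4_S, coe_double, N4]
  ring

lemma regular_M4 : Regular M4 := by
  have := ((regular_E4.comp_double.const_mul 4).add regular_E4).const_mul (1 / 5)
  convert this using 2
  rw [M4]; ring

lemma regular_N4 : Regular N4 := by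
  have := ((regular_E4.comp_double.const_mul 4).sub regular_E4).const_mul (1 / 3)
  convert this using 2
  rw [N4]; ring

lemma tendsto_M4 : Tendsto M4 atImInfty (𝓝 1) := by
  have := (((tendsto_E4.comp tendsto_double).const_mul 4).add tendsto_E4).div_const 5
  norm_num at this
  exact this

lemma tendsto_N4 : Tendsto N4 atImInfty (𝓝 1) := by
  have := (((tendsto_E4.comp tendsto_double).const_mul 4).sub tendsto_E4).div_const 3
  norm_num at this
  exact this

theorem M4_eq_M2_sq (z : ℍ) : M4 z = M2 z ^ 2 := by
  refine sub_eq_zero.mp (eq_zero_of_weight_four (regular_M4.sub (regular_M2.pow 2)) ?_ ?_ z)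
  · intro z; rw [M4_fricke, M2_fricke]; ring
  · simpa using tendsto_M4.sub (tendsto_M2.pow 2)

lemma weight_four_eq {G : ℍ → ℂ} (hG : Regular G)
    (hW : ∀ z, G (fricke z) = 4 * (z : ℂ) ^ 4 * G z) {L : ℂ} (hL : Tendsto G atImInfty (𝓝 L)) :
    ∀ z, G z = L * M2 z ^ 2 := by
  intro z
  refine sub_eq_zero.mp (eq_zero_of_weight_four (hG.sub ((regular_M2.pow 2).const_mul L)) ?_ ?_ z)
  · intro z; rw [hW, M2_fricke]; ring
  · simpa using hL.sub ((tendsto_M2.pow 2).const_mul L)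

lemma weight_eight_eq {G : ℍ → ℂ} (hG : Regular G)
    (hW : ∀ z, G (fricke z) = 16 * (z : ℂ) ^ 8 * G z) {L : ℂ} (hL : Tendsto G atImInfty (𝓝 L)) :
    ∃ β, ∀ z, G z = L * M2 z ^ 4 + β * M8 z := by
  obtain ⟨β, hβ⟩ := exists_eq_mul_M8_of_weight_eight
    (hG.sub ((regular_M2.pow 4).const_mul L)) (fun z => by rw [hW, M2_fricke]; ring)
    (by simpa using hL.sub ((tendsto_M2.pow 4).const_mul L))
  exact ⟨β, fun z => by linear_combination hβ z⟩

/-- The square of the Serre derivative of `M₂`. -/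
theorem serre_M2_sq (z : ℍ) :
    (4 * D M2 z - P2 z * M2 z) ^ 2 = M2 z ^ 4 - 256 * M8 z := by
  have hK : Regular (fun z => 4 * D M2 z - P2 z * M2 z) :=
    (regular_M2.normalizedDeriv.const_mul 4).sub (regular_P2.mul regular_M2)
  have hKW : ∀ z, 4 * D M2 (fricke z) - P2 (fricke z) * M2 (fricke z) =
      -(4 * (z : ℂ) ^ 4) * (4 * D M2 z - P2 z * M2 z) := by
    intro z
    have hd := D_fricke regular_M2.hol M2_fricke
      (((((HasD.coe z).pow 2).const_mul (-2)).mul (HasD.of_mdiff regular_M2.hol z)).congr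
        (fun z => by ring) rfl)
    rw [hd, M2_fricke, P2_fricke]
    push_cast
    ring
  have hKlim : Tendsto (fun z => 4 * D M2 z - P2 z * M2 z) atImInfty (𝓝 (-1)) := by
    simpa using (regular_M2.tendsto_D.const_mul 4).sub (tendsto_P2.mul tendsto_M2)
  obtain ⟨β, hβ⟩ := weight_eight_eq (hK.pow 2) (fun z => by rw [hKW]; ring) (hKlim.pow 2)
  have hX : Regular (fun z => (M2 z - 1) / M8 z) :=
    (regular_M2.sub (Regular.const 1)).div_M8 (by simpa using tendsto_M2.sub_const 1)
  have hD : ∀ z, D M2 z / M8 z = D (fun z => (M2 z - 1) / M8 z) z + (M2 z - 1) / M8 z * P2 z := by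
    intro z
    have h8 := M8_ne_zero z
    rw [((HasD.of_mdiff regular_M2.hol z).sub (HasD.const 1 z) |>.div (hasD_M8 z) h8).eq]
    field_simp
    ring
  have hDlim : Tendsto (fun z => D M2 z / M8 z) atImInfty (𝓝 24) := by
    have := hX.tendsto_D.add (tendsto_M2_sub_one_div.mul tendsto_P2)
    rw [zero_add, mul_one] at this
    exact this.congr fun z => (hD z).symm
  have hβlim := (((hDlim.const_mul 4).sub ((tendsto_P2_sub_one_div.mul tendsto_M2))).add
    (tendsto_M2_sub_one_div.mul tendsto_M2) |>.sub (tendsto_const_nhds (x := (0 : ℂ)))).mul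
    (hKlim.sub (tendsto_M2.pow 2))
  have hβ' : β = -256 := by
    refine tendsto_nhds_unique (tendsto_const_nhds.congr fun z => ?_)
      (hβlim.trans (le_of_eq (by norm_num)))
    have h8 := M8_ne_zero z
    have h1 := hβ z
    have h2 : β = ((4 * D M2 z - P2 z * M2 z) ^ 2 - M2 z ^ 4) / M8 z := by
      rw [eq_div_iff h8]; linear_combination -h1
    rw [h2]
    field_simp
    ring
  rw [hβ z, hβ']
  ring

lemma exists_sign_of_sq_eq {A B : ℍ → ℂ} (hA : MDiff A) (hB : MDiff B)
    (h : ∀ z, A z ^ 2 = B z ^ 2) (h0 : ∀ z, B z ≠ 0) :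
    ∃ s : ℂ, s ^ 2 = 1 ∧ ∀ z, A z = s * B z := by
  rcases isPreconnected_univ.eq_or_eq_neg_of_sq_eq (hA.continuous.continuousOn)
    (hB.continuous.continuousOn) (fun z _ => h z) (fun {z} _ => h0 z) with h | h
  · exact ⟨1, by norm_num, fun z => by simpa using h (Set.mem_univ z)⟩
  · exact ⟨-1, by norm_num, fun z => by simpa using h (Set.mem_univ z)⟩

lemma IsM8HalfPower.ne_zero {k : ℕ} {g : ℍ → ℂ} (hg : IsM8HalfPower k g)
    (z : ℍ) : g z ≠ 0 := fun h =>
  pow_ne_zero k (M8_ne_zero z) (by rw [← hg.2 z, h]; norm_num)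

lemma IsM8HalfPower.hasD {k : ℕ} {g : ℍ → ℂ} (hg : IsM8HalfPower k g)
    (z : ℍ) : HasD g ((k : ℂ) / 2 * P2 z * g z) z := by
  have h1 := (HasD.of_mdiff hg.1 z).pow 2
  have h2 := (hasD_M8 z).pow k
  have h3 := (h2.congr hg.2 rfl).eq
  rw [h1.eq] at h3
  have h0 := hg.ne_zero z
  have h4 : (k : ℂ) * M8 z ^ (k - 1) * (P2 z * M8 z) = k * P2 z * g z ^ 2 := by
    rw [hg.2]
    rcases k with _ | k
    · simp
    · rw [Nat.add_sub_cancel, pow_succ]; ring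
  rw [h4] at h3
  refine (HasD.of_mdiff hg.1 z).congr (fun _ => rfl) ?_
  have h5 : g z * ((k : ℂ) / 2 * P2 z * g z - D g z) = 0 := by
    norm_num at h3
    linear_combination -h3 / 2
  rcases mul_eq_zero.mp h5 with h | h
  · exact absurd h h0
  · linear_combination h

lemma IsM8HalfPower.exists_shift {k : ℕ} {g : ℍ → ℂ} (hg : IsM8HalfPower k g)
    : ∃ t : ℂ, t ^ 2 = 1 ∧ ∀ z, g (shift z) = t * g z :=
  exists_sign_of_sq_eq (mdiff_comp_shift hg.1) hg.1
    (fun z => by rw [hg.2, hg.2, M8_shift]) hg.ne_zero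

lemma IsM8HalfPower.exists_fricke {k : ℕ} {g : ℍ → ℂ} (hg : IsM8HalfPower k g) :
    ∃ s : ℂ, s ^ 2 = 1 ∧ ∀ z, g (fricke z) = s * ((4 * (z : ℂ) ^ 4) ^ k * g z) := by
  refine exists_sign_of_sq_eq (mdiff_comp_fricke hg.1)
    (mdiff_mul (mdiff_pow (mdiff_const_mul 4 (mdiff_pow mdiff_coe 4)) k) hg.1) (fun z => ?_)
    fun z => mul_ne_zero (pow_ne_zero _ (mul_ne_zero (by norm_num) (pow_ne_zero _ z.ne_zero)))
      (hg.ne_zero z)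
  rw [hg.2, mul_pow, hg.2, M8_fricke, mul_pow, ← pow_mul, mul_comm k 2, pow_mul]
  congr 2
  ring

/-- The transformation laws of the two components of a depth one quasimodular form of weight `2m`
under translation and the Fricke involution. -/
structure FrickePair (m : ℤ) (ε : ℂ) (f₀ f₁ : ℍ → ℂ) : Prop where
  hol₀ : MDiff f₀
  hol₁ : MDiff f₁
  per₀ : ∀ z, f₀ (shift z) = f₀ z
  per₁ : ∀ z, f₁ (shift z) = f₁ z
  fricke₀ : ∀ z : ℍ, f₀ (fricke z) = ε * (2 * (z : ℂ) ^ 2) ^ m * (f₀ z + f₁ z / z)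
  fricke₁ : ∀ z : ℍ, f₁ (fricke z) = ε * (2 * (z : ℂ) ^ 2) ^ (m - 1) * f₁ z

lemma nearlySum_one (c : ℕ → ℍ → ℂ) (z : ℍ) :
    nearlySum 1 c z = c 0 z + c 1 z / ((z : ℂ) - conj (z : ℂ)) := by
  simp [nearlySum, Finset.sum_range_succ]

lemma sub_conj_ne_zero (z : ℍ) : (z : ℂ) - conj (z : ℂ) ≠ 0 := by
  rw [Complex.sub_conj]
  have : ((z : ℂ).im : ℂ) ≠ 0 := by exact_mod_cast z.im_pos.ne'
  simpa using this

/-- The matrix of the Fricke involution, normalized to determinant one. -/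
def frickeGL : GL (Fin 2) ℝ :=
  Matrix.GeneralLinearGroup.mkOfDetNeZero ((1 / √2 : ℝ) • !![0, -1; 2, 0]) (by
    have h4 : (√2 : ℝ) ≠ 0 := by positivity
    rw [Matrix.det_smul, Matrix.det_fin_two_of]
    simp)

lemma coe_frickeGL : (frickeGL : Matrix (Fin 2) (Fin 2) ℝ) = (1 / √2 : ℝ) • !![0, -1; 2, 0] := rfl

lemma frickeGL_mem : frickeGL ∈ atkinLehnerCoset :=
  ⟨0, -1, 1, 0, by norm_num, by rw [coe_frickeGL]; simp⟩

lemma det_eq_one_of_mem {γ : GL (Fin 2) ℝ} (h : γ ∈ atkinLehnerCoset) : γ.det.val = 1 := by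
  obtain ⟨a, b, c, d, h1, h2⟩ := h
  have h3 : (4 * a * d - 2 * b * c : ℝ) = 2 := by exact_mod_cast h1
  have h4 : (√2 : ℝ) ^ 2 = 2 := Real.sq_sqrt (by norm_num)
  rw [Matrix.GeneralLinearGroup.val_det_apply, h2, Matrix.det_smul, Matrix.det_fin_two_of]
  have h5 : (2 * a * (2 * d) - b * (2 * c) : ℝ) = 2 := by linarith
  simp only [Fintype.card_fin]
  rw [h5, div_pow, h4]
  norm_num

lemma slash_apply_of_mem {γ : GL (Fin 2) ℝ} (h : γ ∈ atkinLehnerCoset) (k : ℤ) (F : ℍ → ℂ)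
    (z : ℍ) : (F ∣[k] γ) z = F (γ • z) * denom γ z ^ (-k) := by
  rw [ModularForm.slash_apply, σ, if_pos (det_pos_of_mem h), det_eq_one_of_mem h]
  simp

lemma sqrt_two_sq : ((√2 : ℝ) : ℂ) ^ 2 = 2 := by
  exact_mod_cast Real.sq_sqrt (by norm_num : (0 : ℝ) ≤ 2)

lemma sqrt_two_ne_zero : ((√2 : ℝ) : ℂ) ≠ 0 := fun h => by
  have := sqrt_two_sq
  rw [h] at this
  norm_num at this

lemma denom_frickeGL (z : ℍ) : denom frickeGL z = (√2 : ℝ) * z := by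
  have h1 := sqrt_two_sq
  have h2 := sqrt_two_ne_zero
  rw [denom, coe_frickeGL]
  simp
  field_simp
  exact Or.inl h1.symm

lemma frickeGL_smul (z : ℍ) : frickeGL • z = fricke z := by
  have h2 := sqrt_two_ne_zero
  have hz := z.ne_zero
  ext
  rw [coe_smul_of_det_pos (det_pos_of_mem frickeGL_mem), coe_fricke, num, denom, coe_frickeGL]
  simp
  field_simp

lemma fricke_law {m : ℤ} {s : ℤˣ} {F : ℍ → ℂ} (hF : IsModularWithSign (2 * m) s F) (z : ℍ) :
    F (fricke z) = ((s : ℤ) : ℂ) * (2 * (z : ℂ) ^ 2) ^ m * F z := by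
  have h := congrFun (hF.sign _ frickeGL_mem) z
  rw [slash_apply_of_mem frickeGL_mem, frickeGL_smul, denom_frickeGL, Pi.smul_apply,
    smul_eq_mul] at h
  have hz := z.ne_zero
  have h2 := sqrt_two_ne_zero
  have h3 : ((√2 : ℝ) * (z : ℂ)) ^ (2 * m) = (2 * (z : ℂ) ^ 2) ^ m := by
    rw [zpow_mul, ← sqrt_two_sq, ← mul_pow]
    norm_cast
  have h0 : (2 * (z : ℂ) ^ 2) ^ m ≠ 0 := zpow_ne_zero _ (by simpa using hz)
  rw [zpow_neg, h3] at h
  rw [mul_right_comm, ← h, inv_mul_cancel_right₀ h0]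

lemma shift_law {k : ℤ} {s : ℤˣ} {F : ℍ → ℂ} (hF : IsModularWithSign k s F) (z : ℍ) :
    F (shift z) = F z := by
  have h := congrFun (hF.invariant ModularGroup.T (by
    rw [CongruenceSubgroup.Gamma0_mem]; simp [ModularGroup.T])) z
  rw [ModularForm.SL_slash_apply, modular_T_smul_eq_shift] at h
  rw [← h, ModularGroup.denom_apply]
  simp [ModularGroup.T]

lemma sub_conj_fricke (z : ℍ) : ((fricke z : ℍ) : ℂ) - conj ((fricke z : ℍ) : ℂ) =
    ((z : ℂ) - conj (z : ℂ)) / (2 * z * conj (z : ℂ)) := by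
  have h := z.ne_zero
  have h2 : conj (z : ℂ) ≠ 0 := by simpa using h
  rw [coe_fricke]
  simp only [map_div₀, map_neg, map_one, map_mul, Complex.conj_ofNat]
  field_simp
  ring

lemma IsModularWithSign.frickePair {m : ℤ} {s : ℤˣ} {c : ℕ → ℍ → ℂ} (hc : ∀ j ≤ 1, MDiff (c j))
    (hF : IsModularWithSign (2 * m) s (nearlySum 1 c)) :
    FrickePair m ((s : ℤ) : ℂ) (c 0) (c 1) := by
  have h0 := hc 0 zero_le_one
  have h1 := hc 1 le_rfl
  have hT := eq_zero_of_add_mul_im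
    (mdiff_sub (mdiff_comp_shift h0) h0) (mdiff_sub (mdiff_comp_shift h1) h1) fun z => by
      have h := shift_law hF z
      rw [nearlySum_one, nearlySum_one, coe_shift] at h
      have hz := sub_conj_ne_zero z
      simp only [map_add, map_one, add_sub_add_right_eq_sub] at h
      field_simp at h
      linear_combination h
  have hp : MDiff (fun z : ℍ => ((2 * (z : ℂ) ^ 2) ^ m : ℂ)) := mdiff_of_hasD fun z =>
    ⟨_, (((HasD.coe z).pow 2).const_mul 2).zpow m (by simpa using z.ne_zero)⟩
  have hW := eq_zero_of_add_mul_im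
    (mdiff_sub (mdiff_sub (mdiff_comp_fricke h0)
      (mdiff_mul (mdiff_const_mul 2 mdiff_coe) (mdiff_comp_fricke h1)))
      (mdiff_mul (mdiff_const_mul ((s : ℤ) : ℂ) hp) h0))
    (mdiff_sub (mdiff_mul (mdiff_const_mul 2 (mdiff_pow mdiff_coe 2)) (mdiff_comp_fricke h1))
      (mdiff_mul (mdiff_const_mul ((s : ℤ) : ℂ) hp) h1)) fun z => by
      have h := fricke_law hF z
      rw [nearlySum_one, nearlySum_one, sub_conj_fricke] at h
      have hz := sub_conj_ne_zero z
      generalize (2 * (z : ℂ) ^ 2) ^ m = p at h ⊢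
      field_simp at h
      linear_combination h
  have hW1 : ∀ z : ℍ, c 1 (fricke z) =
      ((s : ℤ) : ℂ) * (2 * (z : ℂ) ^ 2) ^ (m - 1) * c 1 z := by
    intro z
    have hz' := z.ne_zero
    have hz : (2 * (z : ℂ) ^ 2) ≠ 0 := by simpa using hz'
    have h := hW.2 z
    rw [zpow_sub_one₀ hz]
    field_simp
    linear_combination h
  refine ⟨h0, h1, fun z => sub_eq_zero.mp (hT.1 z), fun z => sub_eq_zero.mp (hT.2 z), ?_, hW1⟩
  intro z
  have hz' := z.ne_zero
  have hz : (2 * (z : ℂ) ^ 2) ≠ 0 := by simpa using hz'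
  have h := hW.1 z
  rw [hW1, zpow_sub_one₀ hz] at h
  field_simp at h ⊢
  linear_combination h

/-- The second component of a depth one quasimodular form is bounded at `i∞`. -/
lemma regular_of_cusps {k : ℤ} {s : ℤˣ} {c : ℕ → ℍ → ℂ} (h1 : MDiff (c 1))
    (hper : ∀ z, c 1 (shift z) = c 1 z) (hF : IsModularWithSign k s (nearlySum 1 c))
    (h0 : Regular (c 0)) : Regular (c 1) := by
  obtain ⟨L, hL⟩ := hF.cusps 1
  rw [SlashAction.slash_one] at hL
  obtain ⟨a, ha⟩ := h0.exists_tendsto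
  have hq : Tendsto (fun z : ℍ => ((z : ℂ) - conj (z : ℂ)) * nome z) atImInfty (𝓝 0) := by
    rw [tendsto_zero_iff_norm_tendsto_zero]
    have e : ∀ z : ℍ, ‖((z : ℂ) - conj (z : ℂ)) * nome z‖ =
        (1 / Real.pi) * ((2 * Real.pi * z.im) ^ 1 * Real.exp (-(2 * Real.pi * z.im))) := by
      intro z
      have hp := Real.pi_pos
      rw [norm_mul, nome_eq, Complex.norm_exp, Complex.sub_conj]
      have h2 : ‖(2 * (z : ℂ).im : ℝ) * Complex.I‖ = 2 * z.im := by
        rw [norm_mul, Complex.norm_I, mul_one, Complex.norm_real, Real.norm_eq_abs, abs_of_pos]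
        · rfl
        · exact mul_pos two_pos z.im_pos
      have h3 : (2 * Real.pi * Complex.I * (z : ℂ)).re = -(2 * Real.pi * z.im) := by
        simp
      rw [h3, h2]
      field_simp
    have h2 := ((Real.tendsto_pow_mul_exp_neg_atTop_nhds_zero 1).comp
      ((tendsto_comap (f := UpperHalfPlane.im) (x := atTop)).const_mul_atTop
        Real.two_pi_pos)).const_mul (1 / Real.pi)
    rw [mul_zero] at h2
    exact h2.congr fun z => (e z).symm
  have h3 : Tendsto (fun z => c 1 z * M8 z) atImInfty (𝓝 0) := by
    have := ((hL.sub ha).mul hq).mul tendsto_M8unit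
    rw [mul_zero, zero_mul] at this
    refine this.congr fun z => ?_
    have hz := sub_conj_ne_zero z
    rw [nearlySum_one, M8_eq_nome_mul]
    field_simp
    ring
  have h4 : Regular (fun z => c 1 z * M8 z) :=
    ⟨mdiff_mul h1 mdiff_M8, fun z => by rw [hper, M8_shift], h3.isBigO_one ℝ⟩
  have h5 := h4.div_M8 h3
  convert h5 using 2 with z
  rw [mul_div_cancel_right₀ _ (M8_ne_zero z)]

/-- The data of a depth one form of weight `4k + 2` normalized by a branch of `M₈^{k/2}`:
`φ` and `ψ` span a two-dimensional space stable under translation and the Fricke involution. -/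
structure NormalizedPair (t σ : ℂ) (φ ψ : ℍ → ℂ) : Prop where
  ht : t ^ 2 = 1
  hσ : σ ^ 2 = 1
  hol : MDiff φ
  hol' : MDiff ψ
  shift : ∀ z, φ (shift z) = t * φ z
  shift' : ∀ z, ψ (QuasiLevelTwo.shift z) = t * (ψ z + φ z)
  fricke : ∀ z : ℍ, φ (fricke z) = 2 * σ * (z * ψ z)
  fricke' : ∀ z : ℍ, ψ (QuasiLevelTwo.fricke z) = -σ * (z * φ z)

/-- The Wronskian with respect to the normalized derivative. -/
def wronskian (φ ψ : ℍ → ℂ) (z : ℍ) : ℂ := φ z * D ψ z - ψ z * D φ z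

/-- `M₂³ D²(φ / M₂)` written without denominators. -/
def clearedDeriv (φ : ℍ → ℂ) (z : ℍ) : ℂ :=
  M2 z ^ 2 * D (D φ) z - 2 * M2 z * D M2 z * D φ z
    + φ z * (2 * D M2 z ^ 2 - M2 z * D (D M2) z)

/-- The potential of the second order equation satisfied by `φ` and `ψ`, multiplied by `M₂²`. -/
def potential (c : ℂ) (φ ψ : ℍ → ℂ) (z : ℍ) : ℂ :=
  (D (D φ) z * D ψ z - D φ z * D (D ψ) z) / c + 2 * D M2 z ^ 2 - M2 z * D (D M2) z

lemma mdiff_wronskian {φ ψ : ℍ → ℂ} (h : MDiff φ) (h' : MDiff ψ) : MDiff (wronskian φ ψ) :=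
  mdiff_sub (mdiff_mul h (mdiff_D h')) (mdiff_mul h' (mdiff_D h))

lemma D_wronskian {φ ψ : ℍ → ℂ} (h : MDiff φ) (h' : MDiff ψ) (z : ℍ) :
    D (wronskian φ ψ) z = φ z * D (D ψ) z - ψ z * D (D φ) z :=
  (((HasD.of_mdiff h z).mul (HasD.of_mdiff (mdiff_D h') z)).sub
    ((HasD.of_mdiff h' z).mul (HasD.of_mdiff (mdiff_D h) z))).congr (fun _ => rfl) (by ring) |>.eq

lemma D_M2_fricke (z : ℍ) : D M2 (QuasiLevelTwo.fricke z) =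
    -4 * (2 * kap * z ^ 3 * M2 z + z ^ 4 * D M2 z) :=
  (QuasiLevelTwo.D_fricke mdiff_M2 M2_fricke
    (((((HasD.coe z).pow 2).const_mul (-2)).mul (HasD.of_mdiff mdiff_M2 z)).congr
      (fun z => by ring) rfl)).trans (by push_cast; ring)

lemma DD_M2_fricke (z : ℍ) : D (D M2) (QuasiLevelTwo.fricke z) =
    -8 * (6 * kap ^ 2 * z ^ 4 * M2 z + 6 * kap * z ^ 5 * D M2 z + z ^ 6 * D (D M2) z) :=
  (QuasiLevelTwo.D_fricke (mdiff_D mdiff_M2) D_M2_fricke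
    (((((((HasD.coe z).pow 3).const_mul (2 * kap)).mul (HasD.of_mdiff mdiff_M2 z)).add
      (((HasD.coe z).pow 4).mul (HasD.of_mdiff (mdiff_D mdiff_M2) z))).const_mul (-4)))).trans
    (by push_cast; ring)

namespace NormalizedPair

variable {t σ : ℂ} {φ ψ : ℍ → ℂ}

lemma D_shift (h : NormalizedPair t σ φ ψ) (z : ℍ) : D φ (QuasiLevelTwo.shift z) = t * D φ z :=
  QuasiLevelTwo.D_shift h.hol h.shift ((HasD.of_mdiff h.hol z).const_mul t)

lemma D_shift' (h : NormalizedPair t σ φ ψ)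
    (z : ℍ) : D ψ (QuasiLevelTwo.shift z) = t * (D ψ z + D φ z) :=
  QuasiLevelTwo.D_shift h.hol' h.shift'
    (((HasD.of_mdiff h.hol' z).add (HasD.of_mdiff h.hol z)).const_mul t)

lemma DD_shift (h : NormalizedPair t σ φ ψ)
    (z : ℍ) : D (D φ) (QuasiLevelTwo.shift z) = t * D (D φ) z :=
  QuasiLevelTwo.D_shift (mdiff_D h.hol) h.D_shift ((HasD.of_mdiff (mdiff_D h.hol) z).const_mul t)

lemma DD_shift' (h : NormalizedPair t σ φ ψ)
    (z : ℍ) : D (D ψ) (QuasiLevelTwo.shift z) = t * (D (D ψ) z + D (D φ) z) :=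
  QuasiLevelTwo.D_shift (mdiff_D h.hol') h.D_shift'
    (((HasD.of_mdiff (mdiff_D h.hol') z).add (HasD.of_mdiff (mdiff_D h.hol) z)).const_mul t)

lemma D_fricke (h : NormalizedPair t σ φ ψ) (z : ℍ) : D φ (QuasiLevelTwo.fricke z) =
    4 * σ * (kap * (z ^ 2 * ψ z) + z ^ 3 * D ψ z) :=
  (QuasiLevelTwo.D_fricke h.hol h.fricke
    (((HasD.coe z).mul (HasD.of_mdiff h.hol' z)).const_mul (2 * σ))).trans (by ring)

lemma D_fricke' (h : NormalizedPair t σ φ ψ) (z : ℍ) : D ψ (QuasiLevelTwo.fricke z) =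
    -2 * σ * (kap * (z ^ 2 * φ z) + z ^ 3 * D φ z) :=
  (QuasiLevelTwo.D_fricke h.hol' h.fricke'
    (((HasD.coe z).mul (HasD.of_mdiff h.hol z)).const_mul (-σ))).trans (by ring)

lemma DD_fricke (h : NormalizedPair t σ φ ψ) (z : ℍ) : D (D φ) (QuasiLevelTwo.fricke z) =
    8 * σ * (2 * kap ^ 2 * z ^ 3 * ψ z + 4 * kap * z ^ 4 * D ψ z + z ^ 5 * D (D ψ) z) :=
  (QuasiLevelTwo.D_fricke (mdiff_D h.hol) h.D_fricke
    ((((((HasD.coe z).pow 2).mul (HasD.of_mdiff h.hol' z)).const_mul kap).add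
      (((HasD.coe z).pow 3).mul (HasD.of_mdiff (mdiff_D h.hol') z))).const_mul (4 * σ))).trans
    (by push_cast; ring)

lemma DD_fricke' (h : NormalizedPair t σ φ ψ) (z : ℍ) : D (D ψ) (QuasiLevelTwo.fricke z) =
    -4 * σ * (2 * kap ^ 2 * z ^ 3 * φ z + 4 * kap * z ^ 4 * D φ z + z ^ 5 * D (D φ) z) :=
  (QuasiLevelTwo.D_fricke (mdiff_D h.hol') h.D_fricke'
    ((((((HasD.coe z).pow 2).mul (HasD.of_mdiff h.hol z)).const_mul kap).add
      (((HasD.coe z).pow 3).mul (HasD.of_mdiff (mdiff_D h.hol) z))).const_mul (-2 * σ))).trans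
    (by push_cast; ring)

lemma wronskian_fricke (h : NormalizedPair t σ φ ψ) (z : ℍ) :
    wronskian φ ψ (QuasiLevelTwo.fricke z) = 4 * (z : ℂ) ^ 4 * wronskian φ ψ z := by
  simp only [wronskian, h.fricke, h.fricke', h.D_fricke, h.D_fricke']
  linear_combination 4 * (z : ℂ) ^ 4 * (φ z * D ψ z - ψ z * D φ z) * h.hσ

lemma ne_zero_of_wronskian (h : NormalizedPair t σ φ ψ)
    {c : ℂ} (hw : ∀ z, wronskian φ ψ z = c * M2 z ^ 2)
    (h0 : ∃ z, φ z ≠ 0) : c ≠ 0 := by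
  rintro rfl
  obtain ⟨l, hl⟩ := exists_eq_mul_of_wronskian_eq_zero h.hol h.hol' h0
    fun z => by simpa [wronskian] using hw z
  obtain ⟨z, hz⟩ := h0
  have h1 := h.shift' z
  rw [hl, hl, h.shift] at h1
  have h2 : t * φ z = 0 := by linear_combination -h1
  have h3 : t ≠ 0 := by rintro rfl; simpa using h.ht
  simp_all

lemma second_order (h : NormalizedPair t σ φ ψ)
    {c : ℂ} (hw : ∀ z, wronskian φ ψ z = c * M2 z ^ 2)
    (z : ℍ) : φ z * D (D ψ) z - ψ z * D (D φ) z = 2 * c * M2 z * D M2 z := by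
  rw [← D_wronskian h.hol h.hol']
  exact ((((HasD.of_mdiff mdiff_M2 z).pow 2).const_mul c).congr hw rfl).eq.trans (by
    push_cast; ring)

lemma clearedDeriv_eq (h : NormalizedPair t σ φ ψ)
    {c : ℂ} (hw : ∀ z, wronskian φ ψ z = c * M2 z ^ 2) (hc : c ≠ 0) (z : ℍ) :
    clearedDeriv φ z = potential c φ ψ z * φ z := by
  have h1 := hw z
  have h2 := h.second_order hw z
  unfold wronskian at h1
  unfold clearedDeriv potential
  field_simp
  linear_combination -D (D φ) z * h1 + D φ z * h2

lemma clearedDeriv_eq' (h : NormalizedPair t σ φ ψ)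
    {c : ℂ} (hw : ∀ z, wronskian φ ψ z = c * M2 z ^ 2) (hc : c ≠ 0) (z : ℍ) :
    clearedDeriv ψ z = potential c φ ψ z * ψ z := by
  have h1 := hw z
  have h2 := h.second_order hw z
  unfold wronskian at h1
  unfold clearedDeriv potential
  field_simp
  linear_combination -D (D ψ) z * h1 + D ψ z * h2

lemma potential_shift (h : NormalizedPair t σ φ ψ) {c : ℂ} (z : ℍ) :
    potential c φ ψ (QuasiLevelTwo.shift z) = potential c φ ψ z := by
  have e1 := regular_M2.normalizedDeriv.per
  have e2 := regular_M2.normalizedDeriv.normalizedDeriv.per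
  simp only [potential, h.D_shift, h.D_shift', h.DD_shift, h.DD_shift', regular_M2.per, e1, e2]
  linear_combination (D (D φ) z * D ψ z - D φ z * D (D ψ) z) / c * h.ht

lemma potential_fricke (h : NormalizedPair t σ φ ψ)
    {c : ℂ} (hw : ∀ z, wronskian φ ψ z = c * M2 z ^ 2) (hc : c ≠ 0) (z : ℍ) :
    potential c φ ψ (QuasiLevelTwo.fricke z) = 16 * (z : ℂ) ^ 8 * potential c φ ψ z := by
  have h1 := hw z
  have h2 := h.second_order hw z
  unfold wronskian at h1
  simp only [potential, h.D_fricke, h.D_fricke', h.DD_fricke, h.DD_fricke', D_M2_fricke,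
    DD_M2_fricke, M2_fricke]
  field_simp
  have h3 := h.hσ
  linear_combination (-32 * kap ^ 2 * z ^ 6) * h1 + (-16 * kap * z ^ 7) * h2
    + (32 * z ^ 6 * kap ^ 2 * (ψ z * D φ z - φ z * D ψ z)
      + 16 * z ^ 7 * kap * (ψ z * D (D φ) z - φ z * D (D ψ) z)
      + 16 * z ^ 8 * (D ψ z * D (D φ) z - D (D ψ) z * D φ z)) * h3

end NormalizedPair

/-- The elliptic point `(1 + i) / 2`. -/
def ellipticPt : ℍ := ⟨(1 + Complex.I) / 2, by simp⟩

lemma coe_ellipticPt : (ellipticPt : ℂ) = (1 + Complex.I) / 2 := rfl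

lemma ellipticPt_sq : (ellipticPt : ℂ) ^ 2 = Complex.I / 2 := by
  rw [coe_ellipticPt]
  linear_combination Complex.I_sq / 4

lemma shift_fricke_ellipticPt : shift (fricke ellipticPt) = ellipticPt := by
  have h := ellipticPt.ne_zero
  have h2 := Complex.I_sq
  ext
  rw [coe_shift, coe_fricke]
  rw [coe_ellipticPt] at h ⊢
  have h' : 1 + Complex.I ≠ 0 := fun e => h (by rw [e, zero_div])
  field_simp
  linear_combination -h2

lemma M2_ellipticPt : M2 ellipticPt = 0 := by
  have h := regular_M2.per (fricke ellipticPt)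
  rw [shift_fricke_ellipticPt, M2_fricke, ellipticPt_sq] at h
  have h2 : (1 + Complex.I) * M2 ellipticPt = 0 := by linear_combination h
  rcases mul_eq_zero.mp h2 with h3 | h3
  · have := congrArg Complex.re h3
    simp at this
  · exact h3

lemma D_M2_ellipticPt_sq : D M2 ellipticPt ^ 2 = -16 * M8 ellipticPt := by
  have h := serre_M2_sq ellipticPt
  rw [M2_ellipticPt] at h
  linear_combination h / 16

lemma exists_M2_ne_zero : ∃ z, M2 z ≠ 0 := by
  by_contra! h
  exact zero_ne_one (tendsto_nhds_unique (tendsto_const_nhds.congr fun z => (h z).symm) tendsto_M2)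

lemma M2_cancel {F : ℍ → ℂ} (hF : MDiff F) (h : ∀ z, M2 z * F z = 0) (z : ℍ) : F z = 0 := by
  rcases eq_zero_or_eq_zero_of_mul mdiff_M2 hF h with h1 | h1
  · obtain ⟨w, hw⟩ := exists_M2_ne_zero
    exact absurd (h1 w) hw
  · exact h1 z

lemma NormalizedPair.mdiff_potential {t σ : ℂ} {φ ψ : ℍ → ℂ} (h : NormalizedPair t σ φ ψ)
    {c : ℂ} (hc : c ≠ 0) : MDiff (potential c φ ψ) := by
  have h1 := mdiff_D h.hol
  have h2 := mdiff_D h.hol'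
  have h3 := mdiff_D mdiff_M2
  exact mdiff_sub (mdiff_add (mdiff_div (mdiff_sub (mdiff_mul (mdiff_D h1) h2)
    (mdiff_mul h1 (mdiff_D h2))) (mdiff_const c) fun _ => hc)
    (mdiff_const_mul 2 (mdiff_pow h3 2))) (mdiff_mul mdiff_M2 (mdiff_D h3))

/-- The limit of the potential is determined by the exponent of the solution at `i∞`. -/
lemma NormalizedPair.tendsto_potential {t σ : ℂ} {φ ψ : ℍ → ℂ} (h : NormalizedPair t σ φ ψ)
    {c : ℂ} (hw : ∀ z, wronskian φ ψ z = c * M2 z ^ 2) (hc : c ≠ 0) {k : ℕ} {g F : ℍ → ℂ}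
    (hg : IsM8HalfPower k g) (hF : Regular F) (hφ : ∀ z, φ z = g z * F z) {a : ℂ} (ha : a ≠ 0)
    (hlim : Tendsto F atImInfty (𝓝 a)) :
    Tendsto (potential c φ ψ) atImInfty (𝓝 (((k : ℂ) / 2) ^ 2)) := by
  have e1 : ∀ z, D φ z = g z * ((k : ℂ) / 2 * (P2 z * F z) + D F z) := fun z =>
    (((hg.hasD z).mul (HasD.of_mdiff hF.hol z)).congr hφ (by ring)).eq
  have e2 : ∀ z, D (D φ) z = g z * ((k : ℂ) / 2 * (P2 z * ((k : ℂ) / 2 * (P2 z * F z) + D F z))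
      + ((k : ℂ) / 2 * (D P2 z * F z + P2 z * D F z) + D (D F) z)) := fun z =>
    (((hg.hasD z).mul ((((HasD.of_mdiff mdiff_P2 z).mul (HasD.of_mdiff hF.hol z)).const_mul
      ((k : ℂ) / 2)).add (HasD.of_mdiff (mdiff_D hF.hol) z))).congr e1 (by ring)).eq
  have hDF := hF.tendsto_D
  have hDDF := hF.normalizedDeriv.tendsto_D
  have hDP := regular_P2.tendsto_D
  have hDM := regular_M2.tendsto_D
  have hDDM := regular_M2.normalizedDeriv.tendsto_D
  have t1 := ((tendsto_P2.mul hlim).const_mul ((k : ℂ) / 2)).add hDF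
  have t2 := ((tendsto_P2.mul t1).const_mul ((k : ℂ) / 2)).add
    ((((hDP.mul hlim).add (tendsto_P2.mul hDF)).const_mul ((k : ℂ) / 2)).add hDDF)
  have t3 := ((((tendsto_M2.pow 2).mul t2).sub (((tendsto_M2.const_mul 2).mul hDM).mul t1)).add
    (hlim.mul (((hDM.pow 2).const_mul 2).sub (tendsto_M2.mul hDDM)))).div hlim ha
  have hne := hlim.eventually_ne ha
  refine (t3.congr' ?_).trans (le_of_eq ?_)
  · filter_upwards [hne] with z hz
    have h1 := h.clearedDeriv_eq hw hc z
    rw [clearedDeriv, hφ, e1, e2] at h1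
    have hgz := hg.ne_zero z
    simp only [Pi.div_apply]
    rw [div_eq_iff hz]
    refine mul_left_cancel₀ hgz ?_
    linear_combination h1
  · congr 1
    field_simp
    ring

/-- A depth one pair of weight `4k + 2` whose first component is divisible by `M₈ ^ k` gives, after
division by `M₈^{k/2}`, solutions of a second order equation with modular potential. -/
theorem exists_potential {k : ℕ} {ε : ℂ} {f₀ f₁ g : ℍ → ℂ} (hg : IsM8HalfPower k g)
    (hε : ε ^ 2 = 1) (h₀ : MDiff f₀) (hp : ∀ z, f₀ (shift z) = f₀ z) (h₁ : Regular f₁)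
    (hdiv : Regular (fun z => f₀ z / M8 z ^ k))
    (hW₀ : ∀ z : ℍ, f₀ (fricke z) = ε * (4 * (z : ℂ) ^ 4) ^ k * (2 * z) * (z * f₀ z + f₁ z))
    (hW₁ : ∀ z : ℍ, f₁ (fricke z) = ε * (4 * (z : ℂ) ^ 4) ^ k * f₁ z)
    (hne : ∃ z, f₀ z ≠ 0) :
    ∃ t σ c β : ℂ, t * σ = ε * (-1) ^ k ∧ c ≠ 0 ∧
      NormalizedPair t σ (fun z => f₀ z / g z) (fun z => z * (f₀ z / g z) + f₁ z / g z) ∧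
      (∀ z, wronskian (fun z => f₀ z / g z) (fun z => z * (f₀ z / g z) + f₁ z / g z) z =
        c * M2 z ^ 2) ∧
      ∀ z, potential c (fun z => f₀ z / g z) (fun z => z * (f₀ z / g z) + f₁ z / g z) z =
        ((k : ℂ) / 2) ^ 2 * M2 z ^ 4 + β * M8 z := by
  obtain ⟨t, ht, hgt⟩ := hg.exists_shift
  obtain ⟨s, hs, hgs⟩ := hg.exists_fricke
  have hg0 := hg.ne_zero
  have ht0 : t ≠ 0 := by rintro rfl; norm_num at ht
  have hs0 : s ≠ 0 := by rintro rfl; norm_num at hs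
  have hm₀ := mdiff_div h₀ hg.1 hg0
  have hm₁ := mdiff_div h₁.hol hg.1 hg0
  obtain ⟨φ, hφ⟩ : ∃ φ : ℍ → ℂ, φ = fun z => f₀ z / g z := ⟨_, rfl⟩
  obtain ⟨ψ, hψ⟩ : ∃ ψ : ℍ → ℂ, ψ = fun z : ℍ => z * (f₀ z / g z) + f₁ z / g z := ⟨_, rfl⟩
  rw [← hφ, ← hψ]
  have hts : t * s = (-1) ^ k := by
    have h := hgt (fricke ellipticPt)
    rw [shift_fricke_ellipticPt, hgs, show (ellipticPt : ℂ) ^ 4 = (ellipticPt ^ 2) ^ 2 by ring,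
      ellipticPt_sq, show 4 * (Complex.I / 2) ^ 2 = -1 by linear_combination Complex.I_sq] at h
    have h3 : ((-1 : ℂ) ^ k) * (-1) ^ k = 1 := by rw [← mul_pow]; norm_num
    refine mul_right_cancel₀ (hg0 ellipticPt) ?_
    linear_combination (-(-1 : ℂ) ^ k) * h + (t * s * g ellipticPt) * (-1) * h3
  have hp4 : ∀ z : ℍ, (4 * (z : ℂ) ^ 4) ^ k ≠ 0 := fun z =>
    pow_ne_zero _ (mul_ne_zero (by norm_num) (pow_ne_zero _ z.ne_zero))
  have hpair : NormalizedPair t (ε * s) φ ψ :=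
    { ht := ht
      hσ := by rw [mul_pow, hε, hs, one_mul]
      hol := hφ ▸ hm₀
      hol' := hψ ▸ mdiff_add (mdiff_mul mdiff_coe hm₀) hm₁
      shift := fun z => by
        have := hg0 z
        simp only [hφ]
        rw [hp, hgt]
        field_simp
        linear_combination -f₀ z * ht
      shift' := fun z => by
        have := hg0 z
        simp only [hφ, hψ]
        rw [hp, hgt, h₁.per, coe_shift]
        field_simp
        linear_combination -((z + 1) * f₀ z + f₁ z) * ht
      fricke := fun z => by
        have := hg0 z
        have := hp4 z
        simp only [hφ, hψ]
        rw [hW₀, hgs]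
        generalize (4 * (z : ℂ) ^ 4) ^ k = p at *
        field_simp
        linear_combination -ε * z * (z * f₀ z + f₁ z) * hs
      fricke' := fun z => by
        have := hg0 z
        have := hp4 z
        have := z.ne_zero
        simp only [hφ, hψ]
        rw [hW₀, hW₁, hgs, coe_fricke]
        generalize (4 * (z : ℂ) ^ 4) ^ k = p at *
        field_simp
        linear_combination ε * z * f₀ z * hs }
  obtain ⟨F, hF⟩ : ∃ F : ℍ → ℂ, F = fun z => f₀ z / M8 z ^ k := ⟨_, rfl⟩
  rw [← hF] at hdiv
  have hφF : ∀ z, φ z = g z * F z := by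
    intro z
    have := hg0 z
    simp only [hφ, hF]
    rw [← hg.2]
    field_simp
  have hψF : ∀ z : ℍ, ψ z = z * (g z * F z) + f₁ z / g z := by
    intro z
    rw [← hφF, hψ, hφ]
  have hDφ : ∀ z, D φ z = _ := fun z =>
    (((hg.hasD z).mul (HasD.of_mdiff hdiv.hol z)).congr hφF rfl).eq
  have hDψ : ∀ z, D ψ z = _ := fun z =>
    ((((HasD.coe z).mul ((hg.hasD z).mul (HasD.of_mdiff hdiv.hol z))).add
      ((HasD.of_mdiff h₁.hol z).div (hg.hasD z) (hg0 z))).congr hψF rfl).eq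
  have hwF : ∀ z, wronskian φ ψ z = kap * M8 z ^ k * F z ^ 2 + F z * D f₁ z
      - f₁ z * (D F z + k * (P2 z * F z)) := by
    intro z
    have := hg0 z
    rw [wronskian, hDφ, hDψ, hφF, hψF, ← hg.2]
    field_simp
    ring
  have hwR : Regular (wronskian φ ψ) := by
    have := ((((regular_M8.pow k).const_mul kap).mul (hdiv.pow 2)).add
      (hdiv.mul h₁.normalizedDeriv)).sub
      (h₁.mul (hdiv.normalizedDeriv.add ((regular_P2.mul hdiv).const_mul k)))
    rwa [show wronskian φ ψ = _ from funext hwF]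
  obtain ⟨c, hclim⟩ := hwR.exists_tendsto
  have hw := weight_four_eq hwR hpair.wronskian_fricke hclim
  have hc : c ≠ 0 := hpair.ne_zero_of_wronskian hw (by
    obtain ⟨z, hz⟩ := hne
    exact ⟨z, by rw [hφ]; exact div_ne_zero hz (hg0 z)⟩)
  obtain ⟨a, ha⟩ := hdiv.exists_tendsto
  have ha0 : a ≠ 0 := by
    rintro rfl
    obtain ⟨b, hb⟩ := h₁.exists_tendsto
    have := (((((tendsto_M8.pow k).const_mul kap).mul (ha.pow 2)).add
      (ha.mul h₁.tendsto_D)).sub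
      (hb.mul (hdiv.tendsto_D.add ((tendsto_P2.mul ha).const_mul (k : ℂ)))))
    refine hc (tendsto_nhds_unique hclim ((this.congr fun z => (hwF z).symm).trans
      (le_of_eq (by simp))))
  have hlim := hpair.tendsto_potential hw hc hg hdiv hφF ha0 ha
  have hR : Regular (potential c φ ψ) :=
    ⟨hpair.mdiff_potential hc, hpair.potential_shift, hlim.isBigO_one ℝ⟩
  obtain ⟨β, hβ⟩ := weight_eight_eq hR (hpair.potential_fricke hw hc) hlim
  exact ⟨t, ε * s, c, β, by rw [← hts]; ring, hc, hpair, hw, hβ⟩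

/-- If `t σ = 1` then the solutions of the second order equation do not both vanish at the
elliptic point. -/
lemma NormalizedPair.ne_zero_ellipticPt {t σ : ℂ} {φ ψ : ℍ → ℂ} (h : NormalizedPair t σ φ ψ)
    (hts : t * σ = 1) {c : ℂ} (hw : ∀ z, wronskian φ ψ z = c * M2 z ^ 2) (hc : c ≠ 0) :
    φ ellipticPt ≠ 0 ∨ ψ ellipticPt ≠ 0 := by
  by_contra! h0
  obtain ⟨h1, h2⟩ := h0
  have hI := Complex.I_sq
  have hz3 : (ellipticPt : ℂ) ^ 3 = (Complex.I - 1) / 4 := by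
    rw [pow_succ, ellipticPt_sq, coe_ellipticPt]
    linear_combination hI / 4
  have e1 := h.D_shift (QuasiLevelTwo.fricke ellipticPt)
  have e2 := h.D_shift' (QuasiLevelTwo.fricke ellipticPt)
  rw [shift_fricke_ellipticPt, h.D_fricke, hz3, h2] at e1
  rw [shift_fricke_ellipticPt, h.D_fricke, h.D_fricke', hz3, h1, h2] at e2
  have e1' : D φ ellipticPt = (Complex.I - 1) * D ψ ellipticPt := by
    linear_combination e1 + (Complex.I - 1) * D ψ ellipticPt * hts
  have e2' : (1 - Complex.I) * D ψ ellipticPt = 0 := by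
    rw [e1'] at e2
    linear_combination e2 / 2 + ((-(Complex.I - 1) ^ 2 / 2 + (Complex.I - 1)) / 2) *
      D ψ ellipticPt * hts - hI / 4 * D ψ ellipticPt
  have hψ' : D ψ ellipticPt = 0 := by
    rcases mul_eq_zero.mp e2' with h3 | h3
    · have := congrArg Complex.re h3
      simp at this
    · exact h3
  have hφ' : D φ ellipticPt = 0 := by rw [e1', hψ', mul_zero]
  have l := ((HasD.of_mdiff h.hol ellipticPt).mul
      (HasD.of_mdiff (mdiff_D (mdiff_D h.hol')) ellipticPt)).sub
    ((HasD.of_mdiff h.hol' ellipticPt).mul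
      (HasD.of_mdiff (mdiff_D (mdiff_D h.hol)) ellipticPt))
  have r := ((((HasD.of_mdiff mdiff_M2 ellipticPt).const_mul (2 * c)).mul
    (HasD.of_mdiff (mdiff_D mdiff_M2) ellipticPt)))
  have := l.eq.symm.trans (r.congr (h.second_order hw) rfl).eq
  rw [h1, h2, hφ', hψ', M2_ellipticPt] at this
  have h8 := M8_ne_zero ellipticPt
  have h4 : c * M8 ellipticPt = 0 := by
    linear_combination this / 32 + c / 16 * D_M2_ellipticPt_sq
  exact (mul_ne_zero hc h8) h4

lemma solvesAt_of_hasD {Q y Y : ℍ → ℂ} {d : ℂ} {z : ℍ} (h : ∀ᶠ w in 𝓝 z, HasD y (Y w) w)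
    (h' : HasD Y d z) (hd : d = Q z * y z) : SolvesAt Q y z := by
  have hev : ∀ᶠ w in 𝓝 (z : ℂ), HasDerivAt (y ∘ ofComplex)
      (2 * (Real.pi : ℂ) * Complex.I * (Y ∘ ofComplex) w) w := by
    rw [← isOpenEmbedding_coe.map_nhds_eq, eventually_map]
    filter_upwards [h] with w hw
    simpa [HasD] using hw
  refine ⟨Complex.analyticAt_iff_eventually_differentiableAt.mpr
    (hev.mono fun w hw => hw.differentiableAt), ?_⟩
  have h2 : deriv (y ∘ ofComplex) =ᶠ[𝓝 (z : ℂ)]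
      fun w => 2 * (Real.pi : ℂ) * Complex.I * (Y ∘ ofComplex) w := hev.mono fun w hw => hw.deriv
  rw [h2.deriv_eq, (HasDerivAt.const_mul _ h').deriv, hd]
  linear_combination (4 * (Real.pi : ℂ) ^ 2 * Q z * y z) * Complex.I_sq

lemma IsModularWithSign.mul {k l : ℤ} {s t : ℤˣ} {F G : ℍ → ℂ} (hF : IsModularWithSign k s F)
    (hG : IsModularWithSign l t G) : IsModularWithSign (k + l) (s * t) (F * G) where
  invariant γ h := by rw [ModularForm.mul_slash_SL2, hF.invariant γ h, hG.invariant γ h]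
  sign γ h := by
    rw [ModularForm.mul_slash, hF.sign γ h, hG.sign γ h, det_eq_one_of_mem h]
    ext z
    simp
    ring
  cusps γ := by
    obtain ⟨L, hL⟩ := hF.cusps γ
    obtain ⟨M, hM⟩ := hG.cusps γ
    exact ⟨L * M, by rw [ModularForm.mul_slash_SL2]; exact hL.mul hM⟩

lemma IsModularWithSign.one : IsModularWithSign 0 1 1 where
  invariant γ _ := ModularForm.is_invariant_one γ
  sign γ h := by
    ext z
    rw [slash_apply_of_mem h]
    simp
  cusps γ := ⟨1, by rw [ModularForm.is_invariant_one]; exact tendsto_const_nhds⟩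

lemma IsModularWithSign.pow {k : ℤ} {s : ℤˣ} {F : ℍ → ℂ} (hF : IsModularWithSign k s F) (n : ℕ) :
    IsModularWithSign (n * k) (s ^ n) (F ^ n) := by
  induction n with
  | zero => simpa using IsModularWithSign.one
  | succ n ih =>
    have := ih.mul hF
    rw [pow_succ, pow_succ]
    convert this using 1
    push_cast
    ring

lemma tendsto_half_vadd (d : ℤ) :
    Tendsto (fun z : ℍ => half ((d : ℝ) +ᵥ z)) atImInfty atImInfty := by
  rw [atImInfty, tendsto_comap_iff]
  have h : Tendsto (fun z : ℍ => (1 / 2) * z.im) (comap UpperHalfPlane.im atTop) atTop :=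
    tendsto_comap.const_mul_atTop (by norm_num)
  refine h.congr fun z => ?_
  change 1 / 2 * z.im = ((((d : ℝ) +ᵥ z : ℍ) : ℂ) / 2).im
  rw [coe_vadd]
  simp
  ring

lemma coe_SL_smul (γ : SL(2, ℤ)) (z : ℍ) : ((γ • z : ℍ) : ℂ) =
    ((γ 0 0 : ℂ) * z + γ 0 1) / ((γ 1 0 : ℂ) * z + γ 1 1) := by
  rw [UpperHalfPlane.coe_specialLinearGroup_apply]
  simp

lemma SL_denom_ne_zero (γ : SL(2, ℤ)) (z : ℍ) : (γ 1 0 : ℂ) * z + γ 1 1 ≠ 0 := by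
  rw [← ModularGroup.denom_apply]
  exact denom_ne_zero _ z

/-- Stabilization from level one to `Γ₀(2)` with a prescribed Atkin-Lehner sign. -/
lemma isModularWithSign_of_levelOne {m : ℕ} {E : ℍ → ℂ}
    (hE : ∀ (γ : SL(2, ℤ)) (z : ℍ), E (γ • z) = ((γ 1 0 : ℂ) * z + γ 1 1) ^ (2 * m) * E z) {L : ℂ}
    (hL : Tendsto E atImInfty (𝓝 L)) (s : ℤˣ) :
    IsModularWithSign (2 * m) s (fun z => 2 ^ m * E (double z) + ((s : ℤ) : ℂ) * E z) := by
  have hinv : ∀ γ : SL(2, ℤ), γ ∈ CongruenceSubgroup.Gamma0 2 →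
      (fun z => 2 ^ m * E (double z) + ((s : ℤ) : ℂ) * E z) ∣[(2 * m : ℤ)] γ =
        fun z => 2 ^ m * E (double z) + ((s : ℤ) : ℂ) * E z := by
    intro γ h
    rw [CongruenceSubgroup.Gamma0_mem, ZMod.intCast_zmod_eq_zero_iff_dvd] at h
    obtain ⟨c, hc⟩ := h
    push_cast at hc
    have hdet := γ.det_coe
    rw [Matrix.det_fin_two, hc] at hdet
    let γ' : SL(2, ℤ) := ⟨!![γ 0 0, 2 * γ 0 1; c, γ 1 1], by
      rw [Matrix.det_fin_two_of]; linarith⟩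
    ext z
    have hd := SL_denom_ne_zero γ z
    have e : double (γ • z) = γ' • double z := by
      have hd' := SL_denom_ne_zero γ' (double z)
      ext
      rw [coe_double, coe_SL_smul, coe_SL_smul]
      simp only [γ', coe_double, Matrix.of_apply,
        Matrix.cons_val', Matrix.cons_val_zero, Matrix.cons_val_one, Matrix.cons_val_fin_one] at hd' ⊢
      rw [hc] at hd ⊢
      push_cast at hd hd' ⊢
      field_simp
    have e2 : ((γ' 1 0 : ℂ) * (double z : ℍ) + γ' 1 1) = (γ 1 0 : ℂ) * z + γ 1 1 := by
      simp only [γ', coe_double, Matrix.of_apply,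
        Matrix.cons_val', Matrix.cons_val_zero, Matrix.cons_val_one, Matrix.cons_val_fin_one]
      rw [hc]; push_cast; ring
    rw [ModularForm.SL_slash_apply, e, hE, hE, e2, ModularGroup.denom_apply, zpow_neg]
    generalize (γ 1 0 : ℂ) * z + γ 1 1 = j at *
    have : j ^ (2 * (m : ℤ)) = j ^ (2 * m) := by norm_cast
    rw [this]
    field_simp
  refine ⟨hinv, ?_, ?_⟩
  · intro γ h
    have h' := h
    obtain ⟨a, b, c, d, h1, h2⟩ := h'
    have h3 : 2 * a * d - b * c = 1 := by linarith
    let γ₁ : SL(2, ℤ) := ⟨!![a, b; c, 2 * d], by rw [Matrix.det_fin_two_of]; linarith⟩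
    let γ₂ : SL(2, ℤ) := ⟨!![2 * a, b; c, d], by rw [Matrix.det_fin_two_of]; linarith⟩
    ext z
    have r1 := sqrt_two_sq
    have r2 := sqrt_two_ne_zero
    have hd := SL_denom_ne_zero γ₂ z
    have e0 : denom γ z = (√2 : ℝ) * ((c : ℂ) * z + d) := by
      rw [denom, h2]
      simp
      field_simp
      rw [r1]
    have e1 : γ • z = γ₁ • double z := by
      have hd' := SL_denom_ne_zero γ₁ (double z)
      ext
      rw [coe_smul_of_det_pos (det_pos_of_mem h), coe_SL_smul, e0, num, h2]
      simp only [γ₁, γ₂, coe_double, Matrix.of_apply,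
        Matrix.cons_val', Matrix.cons_val_zero, Matrix.cons_val_one, Matrix.cons_val_fin_one]
        at hd hd' ⊢
      push_cast at hd' ⊢
      have e : (c : ℂ) * (2 * z) + 2 * d = 2 * (c * z + d) := by ring
      rw [e]
      simp
      field_simp
      rw [r1]
    have e2 : double (γ • z) = γ₂ • z := by
      ext
      rw [e1, coe_double, coe_SL_smul, coe_SL_smul]
      have hd' := SL_denom_ne_zero γ₁ (double z)
      simp only [γ₁, γ₂, coe_double, Matrix.of_apply,
        Matrix.cons_val', Matrix.cons_val_zero, Matrix.cons_val_one, Matrix.cons_val_fin_one]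
        at hd hd' ⊢
      push_cast at hd' ⊢
      field_simp
    rw [slash_apply_of_mem h, e2, e1, hE, hE, e0, zpow_neg, Pi.smul_apply, smul_eq_mul]
    simp only [γ₁, γ₂, coe_double, Matrix.of_apply,
      Matrix.cons_val', Matrix.cons_val_zero, Matrix.cons_val_one, Matrix.cons_val_fin_one] at hd ⊢
    have e3 : ((√2 : ℝ) * ((c : ℂ) * z + d)) ^ (2 * (m : ℤ)) = 2 ^ m * (c * z + d) ^ (2 * m) := by
      rw [← r1, ← pow_mul, ← mul_pow]
      norm_cast
    have e4 : (((c : ℤ) : ℂ) * (2 * z) + ((2 * d : ℤ) : ℂ)) ^ (2 * m) =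
        2 ^ m * 2 ^ m * (c * z + d) ^ (2 * m) := by
      push_cast
      rw [← mul_pow, show (2 * 2 : ℂ) = 2 ^ 2 by norm_num, ← pow_mul, ← mul_pow]
      ring
    have hs : (((s : ℤ) : ℂ)) * ((s : ℤ) : ℂ) = 1 := by
      rcases Int.units_eq_one_or s with h | h <;> simp [h]
    rw [e3, e4]
    have hj : ((c : ℂ) * z + d) ^ (2 * m) ≠ 0 := pow_ne_zero _ hd
    have h2m : (2 : ℂ) ^ m ≠ 0 := pow_ne_zero _ two_ne_zero
    rw [← div_eq_mul_inv, div_eq_iff (mul_ne_zero h2m hj)]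
    linear_combination (-(2 : ℂ) ^ m * (c * z + d) ^ (2 * m) * E z) * hs
  · intro γ
    by_cases hpar : (2 : ℤ) ∣ γ 1 0
    · rw [hinv γ (by
        rw [CongruenceSubgroup.Gamma0_mem, ZMod.intCast_zmod_eq_zero_iff_dvd]
        exact_mod_cast hpar)]
      exact ⟨_, ((hL.comp tendsto_double).const_mul _).add (hL.const_mul _)⟩
    · have hodd : Odd (γ 1 0) := Int.not_even_iff_odd.mp fun h => hpar h.two_dvd
      obtain ⟨e, he⟩ := hodd
      have hdet := γ.det_coe
      rw [Matrix.det_fin_two] at hdet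
      let γ' : SL(2, ℤ) :=
        ⟨!![2 * γ 0 0, γ 0 1 - γ 0 0 * γ 1 1; γ 1 0, -(γ 1 1 * e)], by
          rw [Matrix.det_fin_two_of]
          linear_combination hdet + γ 0 0 * γ 1 1 * he⟩
      have heC : (γ 1 0 : ℂ) = 2 * e + 1 := by exact_mod_cast he
      have key : ∀ z : ℍ, ((fun z => 2 ^ m * E (double z) + ((s : ℤ) : ℂ) * E z) ∣[(2 * m : ℤ)] γ) z
          = ((2 : ℂ) ^ m)⁻¹ * E (half ((γ 1 1 : ℝ) +ᵥ z)) + ((s : ℤ) : ℂ) * E z := by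
        intro z
        have hd := SL_denom_ne_zero γ z
        have e2 : ((γ' 1 0 : ℂ) * (half ((γ 1 1 : ℝ) +ᵥ z) : ℍ) + γ' 1 1) =
            ((γ 1 0 : ℂ) * z + γ 1 1) / 2 := by
          simp only [γ', coe_half, coe_vadd, Matrix.of_apply,
            Matrix.cons_val', Matrix.cons_val_zero, Matrix.cons_val_one, Matrix.cons_val_fin_one]
          push_cast
          linear_combination (γ 1 1 : ℂ) / 2 * heC
        have e1 : double (γ • z) = γ' • half ((γ 1 1 : ℝ) +ᵥ z) := by
          ext
          rw [coe_double, coe_SL_smul, coe_SL_smul, e2]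
          simp only [γ', coe_half, coe_vadd, Matrix.of_apply,
            Matrix.cons_val', Matrix.cons_val_zero, Matrix.cons_val_one, Matrix.cons_val_fin_one]
          push_cast
          field_simp
          ring
        rw [ModularForm.SL_slash_apply, e1, hE, hE, e2, ModularGroup.denom_apply, zpow_neg]
        generalize (γ 1 0 : ℂ) * z + γ 1 1 = j at *
        have e5 : j ^ (2 * (m : ℤ)) = j ^ (2 * m) := by norm_cast
        have e6 : (2 : ℂ) ^ (2 * m) = 2 ^ m * 2 ^ m := by rw [two_mul, pow_add]
        rw [e5, div_pow, e6]
        field_simp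
      exact ⟨_, (((hL.comp (tendsto_half_vadd (γ 1 1))).const_mul _).add
        (hL.const_mul _)).congr fun z => (key z).symm⟩

/-- The nonholomorphic level one Eisenstein series of weight two. -/
def E2star (z : ℍ) : ℂ := EisensteinSeries.E2 z + 12 * kap / ((z : ℂ) - conj (z : ℂ))

lemma E2star_slash (γ : SL(2, ℤ)) (z : ℍ) :
    E2star (γ • z) = ((γ 1 0 : ℂ) * z + γ 1 1) ^ (2 * 1) * E2star z := by
  have hz := sub_conj_ne_zero z
  have hd := SL_denom_ne_zero γ z
  have hd' : (γ 1 0 : ℂ) * conj (z : ℂ) + γ 1 1 ≠ 0 := by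
    have := (map_ne_zero (starRingEnd ℂ)).mpr hd
    simpa using this
  have hdet := γ.det_coe
  rw [Matrix.det_fin_two] at hdet
  have hdetC : (γ 0 0 : ℂ) * γ 1 1 - γ 0 1 * γ 1 0 = 1 := by exact_mod_cast hdet
  have e : ((γ • z : ℍ) : ℂ) - conj ((γ • z : ℍ) : ℂ) = ((z : ℂ) - conj (z : ℂ)) /
      (((γ 1 0 : ℂ) * z + γ 1 1) * ((γ 1 0 : ℂ) * conj (z : ℂ) + γ 1 1)) := by
    rw [coe_SL_smul]
    simp only [map_div₀, map_add, map_mul, map_intCast]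
    rw [div_sub_div _ _ hd hd']
    congr 1
    linear_combination ((z : ℂ) - conj (z : ℂ)) * hdetC
  rw [E2star, E2star, E2_slash_apply, e]
  field_simp
  ring

lemma tendsto_inv_sub_conj :
    Tendsto (fun z : ℍ => ((z : ℂ) - conj (z : ℂ))⁻¹) atImInfty (𝓝 0) := by
  rw [tendsto_zero_iff_norm_tendsto_zero]
  have h := ((tendsto_comap (f := UpperHalfPlane.im) (x := atTop)).const_mul_atTop
    (two_pos (α := ℝ))).inv_tendsto_atTop
  refine h.congr fun z => ?_
  rw [Complex.sub_conj, norm_inv, norm_mul, Complex.norm_I, mul_one, Complex.norm_real,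
    Real.norm_eq_abs, abs_of_pos (mul_pos two_pos z.coe_im_pos)]
  rfl

lemma tendsto_E2star : Tendsto E2star atImInfty (𝓝 1) := by
  have := tendsto_E2.add (tendsto_inv_sub_conj.const_mul (12 * kap))
  rw [mul_zero, add_zero] at this
  exact this

lemma isModular_M2 : IsModularWithSign 2 (-1) M2 := by
  have := isModularWithSign_of_levelOne (m := 1) E2star_slash tendsto_E2star (-1)
  convert this using 1
  · norm_num
  ext z
  have hz := sub_conj_ne_zero z
  rw [M2, E2star, E2star, coe_double]
  simp only [map_mul, Complex.conj_ofNat, ← mul_sub]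
  push_cast
  field_simp
  ring

lemma isModular_N4 : IsModularWithSign 4 (-1) N4 := by
  have := (isModularWithSign_of_levelOne (m := 2) (E := ModularForm.E₄)
    (fun γ z => E4_slash_apply γ z) tendsto_E4 (-1)).smul (1 / 3)
  convert this using 1
  · norm_num
  ext z
  rw [N4, Pi.smul_apply, smul_eq_mul]
  push_cast
  ring

lemma isModular_P2 :
    IsModularWithSign 2 1 (fun z => P2 z + 8 * kap / ((z : ℂ) - conj (z : ℂ))) := by
  have := (isModularWithSign_of_levelOne (m := 1) E2star_slash tendsto_E2star 1).smul (1 / 3)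
  convert this using 1
  · norm_num
  ext z
  have hz := sub_conj_ne_zero z
  rw [Pi.smul_apply, smul_eq_mul, P2, E2star, E2star, coe_double]
  simp only [map_mul, Complex.conj_ofNat, ← mul_sub]
  push_cast
  field_simp
  ring

lemma isModular_monomial (a b : ℕ) :
    IsModularWithSign (2 * a + 4 * b) ((-1) ^ (a + b)) (M2 ^ a * N4 ^ b) := by
  have := (isModular_M2.pow a).mul (isModular_N4.pow b)
  rw [← pow_add] at this
  convert this using 1
  ring

lemma mdiff_monomial (a b : ℕ) : MDiff (M2 ^ a * N4 ^ b) :=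
  mdiff_mul (mdiff_pow mdiff_M2 a) (mdiff_pow regular_N4.hol b)

lemma mem_quasimodularSpace_of_isModular {k : ℤ} {s : ℤˣ} {B : ℍ → ℂ} (hB : MDiff B)
    (h : IsModularWithSign k s B) : B ∈ quasimodularSpace k 1 s := by
  refine ⟨fun j => if j = 0 then B else 0, rfl, fun j _ => ?_, ?_⟩
  · dsimp only
    split_ifs
    · exact hB
    · exact mdifferentiable_const
  · convert h using 1
    ext z
    rw [nearlySum_one]
    simp

lemma P2_mul_mem_quasimodularSpace {k : ℤ} {s : ℤˣ} {B : ℍ → ℂ} (hB : MDiff B)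
    (h : IsModularWithSign k s B) : P2 * B ∈ quasimodularSpace (2 + k) 1 s := by
  refine ⟨fun j => if j = 0 then P2 * B else fun z => 8 * kap * B z, rfl, fun j _ => ?_, ?_⟩
  · dsimp only
    split_ifs
    · exact mdiff_mul mdiff_P2 hB
    · exact mdiff_const_mul _ hB
  · have := isModular_P2.mul h
    rw [one_mul] at this
    convert this using 1
    ext z
    rw [nearlySum_one]
    simp
    ring

lemma N4_ellipticPt_ne_zero : N4 ellipticPt ≠ 0 := by
  intro h
  obtain ⟨β, hβ⟩ := weight_eight_eq (regular_N4.pow 2)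
    (fun z => by rw [N4_fricke]; ring) (tendsto_N4.pow 2)
  have h1 := hβ ellipticPt
  rw [h, M2_ellipticPt] at h1
  have hβ0 : β = 0 := by simpa [M8_ne_zero] using h1
  have hM : ∀ z, M2 z ^ 2 = 0 := by
    have h2 : ∀ z, (N4 z - M2 z ^ 2) * (N4 z + M2 z ^ 2) = 0 := fun z => by
      have := hβ z
      rw [hβ0] at this
      linear_combination this
    have h4 : ∀ z : ℍ, (4 * (z : ℂ) ^ 4) ≠ 0 := fun z => by simpa using z.ne_zero
    rcases eq_zero_or_eq_zero_of_mul
      (mdiff_sub regular_N4.hol (mdiff_pow mdiff_M2 2))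
      (mdiff_add regular_N4.hol (mdiff_pow mdiff_M2 2)) h2 with h3 | h3
    all_goals
      intro z
      have h5 := h3 (fricke z)
      rw [N4_fricke, M2_fricke] at h5
      have h6 := h3 z
      refine mul_left_cancel₀ (h4 z) ?_
    · linear_combination -h5 / 2 - (4 * (z : ℂ) ^ 4) * h6 / 2
    · linear_combination h5 / 2 + (4 * (z : ℂ) ^ 4) * h6 / 2
  obtain ⟨z, hz⟩ := exists_M2_ne_zero
  exact hz (by simpa using hM z)

lemma mdiff_sum_monomial (l : ℕ → ℂ) (k n : ℕ) : MDiff (fun z => ∑ b ∈ Finset.range n,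
    l b * (M2 z ^ (2 * (k - b)) * N4 z ^ b)) := by
  induction n with
  | zero => simpa using mdiff_const 0
  | succ n ih =>
    simp_rw [Finset.sum_range_succ]
    exact mdiff_add ih (mdiff_const_mul _ (mdiff_monomial _ _))

lemma coeff_eq_zero_of_sum_monomial {k : ℕ} : ∀ {l : ℕ → ℂ},
    (∀ z, ∑ b ∈ Finset.range (k + 1), l b * (M2 z ^ (2 * (k - b)) * N4 z ^ b) = 0) →
    ∀ b ≤ k, l b = 0 := by
  induction k with
  | zero =>
    intro l h b hb
    obtain rfl := Nat.le_zero.mp hb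
    simpa using h ellipticPt
  | succ k ih =>
    intro l h
    have hstep : ∀ z, ∑ b ∈ Finset.range (k + 1 + 1),
        l b * (M2 z ^ (2 * (k + 1 - b)) * N4 z ^ b) =
        M2 z * (M2 z * ∑ b ∈ Finset.range (k + 1), l b * (M2 z ^ (2 * (k - b)) * N4 z ^ b)) +
          l (k + 1) * N4 z ^ (k + 1) := by
      intro z
      rw [Finset.sum_range_succ, Finset.mul_sum, Finset.mul_sum]
      congr 1
      · refine Finset.sum_congr rfl fun b hb => ?_
        have hb' : b ≤ k := Nat.lt_succ_iff.mp (Finset.mem_range.mp hb)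
        rw [show 2 * (k + 1 - b) = 2 * (k - b) + 2 by omega, pow_add]
        ring
      · simp
    have htop : l (k + 1) = 0 := by
      have := h ellipticPt
      rw [hstep, M2_ellipticPt] at this
      simpa [N4_ellipticPt_ne_zero] using this
    have hmd := mdiff_sum_monomial l k (k + 1)
    have hrest := M2_cancel hmd (M2_cancel (mdiff_mul mdiff_M2 hmd) fun z => by
      have := h z
      rw [hstep, htop] at this
      linear_combination this)
    intro b hb
    rcases Nat.lt_or_ge b (k + 1) with hb' | hb'
    · exact ih hrest b (Nat.lt_succ_iff.mp hb')
    · rwa [show b = k + 1 by omega]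

lemma le_of_isExtremal_of_independent {V : Submodule ℂ (ℍ → ℂ)} {n k : ℕ}
    (hV : n + 1 = Module.finrank ℂ V) (e : ℕ → ℍ → ℂ) (he : ∀ b ≤ k, e b ∈ V)
    (hind : ∀ l : ℕ → ℂ, (∀ z, ∑ b ∈ Finset.range (k + 1), l b * e b z = 0) → ∀ b ≤ k, l b = 0) :
    k ≤ n := by
  have : Module.Finite ℂ V := Module.finite_of_finrank_pos (by omega)
  let v : Fin (k + 1) → V := fun i => ⟨e i, he i (Nat.lt_succ_iff.mp i.2)⟩
  have hli : LinearIndependent ℂ v := by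
    rw [Fintype.linearIndependent_iff]
    intro g hg i
    have h := hind (fun b => if h : b < k + 1 then g ⟨b, h⟩ else 0) (fun z => by
      have h1 := congrFun (congrArg Subtype.val hg) z
      rw [Finset.sum_range]
      simpa [v, Fin.is_le] using h1) i (Nat.lt_succ_iff.mp i.2)
    simpa [Fin.is_le] using h
  have := hli.fintype_card_le_finrank
  rw [Fintype.card_fin, ← hV] at this
  omega

lemma coeff_eq_zero_of_sum_mul {k : ℕ} (p : ℕ → Prop) [DecidablePred p] {δ : ℂ} (hδ : δ ≠ 0)
    (hp : ∀ b, (-1 : ℂ) ^ b = if p b then δ else -δ) {l : ℕ → ℂ}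
    (h : ∀ z, ∑ b ∈ Finset.range (k + 1),
      l b * (M2 z ^ (2 * (k - b)) * N4 z ^ b * (if p b then P2 z else M2 z)) = 0) :
    ∀ b ≤ k, l b = 0 := by
  obtain ⟨S, hS⟩ : ∃ S : ℍ → ℂ, ∀ z, S z = ∑ b ∈ Finset.range (k + 1),
      (if p b then l b else 0) * (M2 z ^ (2 * (k - b)) * N4 z ^ b) := ⟨_, fun _ => rfl⟩
  obtain ⟨T, hT⟩ : ∃ T : ℍ → ℂ, ∀ z, T z = ∑ b ∈ Finset.range (k + 1),
      (if p b then 0 else l b) * (M2 z ^ (2 * (k - b)) * N4 z ^ b) := ⟨_, fun _ => rfl⟩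
  have h1 : ∀ z, P2 z * S z + M2 z * T z = 0 := fun z => by
    rw [← h z, hS, hT, Finset.mul_sum, Finset.mul_sum, ← Finset.sum_add_distrib]
    refine Finset.sum_congr rfl fun b _ => ?_
    split_ifs <;> ring
  have hpow : ∀ (z : ℍ), ∀ b ∈ Finset.range (k + 1),
      M2 (fricke z) ^ (2 * (k - b)) * N4 (fricke z) ^ b =
      (4 * (z : ℂ) ^ 4) ^ k * ((-1) ^ b * (M2 z ^ (2 * (k - b)) * N4 z ^ b)) := by
    intro z b hb
    have hb' : b ≤ k := Nat.lt_succ_iff.mp (Finset.mem_range.mp hb)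
    rw [M2_fricke, N4_fricke, pow_mul, ← Nat.sub_add_cancel hb', pow_add, Nat.add_sub_cancel,
      show (-(2 * (z : ℂ) ^ 2) * M2 z) ^ 2 = 4 * (z : ℂ) ^ 4 * M2 z ^ 2 by ring, mul_pow,
      show -(4 * (z : ℂ) ^ 4) * N4 z = 4 * (z : ℂ) ^ 4 * (-1 * N4 z) by ring, mul_pow, mul_pow,
      ← pow_mul]
    ring
  have hSf : ∀ z : ℍ, S (fricke z) = (4 * (z : ℂ) ^ 4) ^ k * (δ * S z) := fun z => by
    rw [hS, hS, Finset.mul_sum, Finset.mul_sum]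
    refine Finset.sum_congr rfl fun b hb => ?_
    rw [hpow z b hb, hp]
    split_ifs <;> ring
  have hTf : ∀ z : ℍ, T (fricke z) = (4 * (z : ℂ) ^ 4) ^ k * (-δ * T z) := fun z => by
    rw [hT, hT, Finset.mul_sum, Finset.mul_sum]
    refine Finset.sum_congr rfl fun b hb => ?_
    rw [hpow z b hb, hp]
    split_ifs <;> ring
  have hS0 : ∀ z, S z = 0 := fun z => by
    have h2 := h1 (fricke z)
    rw [hSf, hTf, P2_fricke, M2_fricke] at h2
    have hz := z.ne_zero
    have h3 : (4 * (z : ℂ) ^ 4) ^ k * δ * (16 * kap * z) * S z = 0 := by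
      linear_combination h2 - (4 * (z : ℂ) ^ 4) ^ k * δ * (2 * z ^ 2) * h1 z
    have h4 : (4 * (z : ℂ) ^ 4) ^ k * δ * (16 * kap * z) ≠ 0 :=
      mul_ne_zero (mul_ne_zero (pow_ne_zero _ (mul_ne_zero (by norm_num) (pow_ne_zero _ hz))) hδ)
        (mul_ne_zero (mul_ne_zero (by norm_num) kap_ne_zero) hz)
    exact (mul_eq_zero.mp h3).resolve_left h4
  have hTd : MDiff T := by
    rw [show T = _ from funext hT]
    exact mdiff_sum_monomial _ _ _
  have hT0 := M2_cancel hTd fun z => by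
    have := h1 z
    rwa [hS0, mul_zero, zero_add] at this
  intro b hb
  have c1 := coeff_eq_zero_of_sum_monomial (fun z => (hS z).symm.trans (hS0 z)) b hb
  have c2 := coeff_eq_zero_of_sum_monomial (fun z => (hT z).symm.trans (hT0 z)) b hb
  by_cases hpb : p b
  · simpa [hpb] using c1
  · simpa [hpb] using c2

lemma le_of_finrank_weight_four_mul_add_two {n k : ℕ}
    (hV : n + 1 = Module.finrank ℂ (quasimodularSpace (4 * (k : ℤ) + 2) 1 ((-1) ^ k))) :
    k ≤ n := by
  refine le_of_isExtremal_of_independent hV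
    (fun b z => M2 z ^ (2 * (k - b)) * N4 z ^ b * (if Even (k + b) then P2 z else M2 z)) ?_ ?_
  · intro b hb
    by_cases hpar : Even (k + b)
    · have := P2_mul_mem_quasimodularSpace (mdiff_monomial (2 * (k - b)) b)
        (isModular_monomial (2 * (k - b)) b)
      convert this using 1
      · congr 1
        · push_cast [Nat.cast_sub hb]
          ring
        · exact neg_one_pow_congr (by grind)
      · ext z
        simp [hpar]
        ring
    · have := mem_quasimodularSpace_of_isModular (mdiff_monomial (2 * (k - b) + 1) b)
        (isModular_monomial (2 * (k - b) + 1) b)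
      convert this using 1
      · congr 1
        · push_cast [Nat.cast_sub hb]
          ring
        · exact neg_one_pow_congr (by grind)
      · ext z
        simp [hpar]
        ring
  · intro l h
    refine coeff_eq_zero_of_sum_mul (fun b => Even (k + b)) (δ := (-1) ^ k)
      (pow_ne_zero _ (by norm_num)) (fun b => ?_) h
    split_ifs with hpar
    · exact neg_one_pow_congr (by grind)
    · rw [neg_eq_neg_one_mul ((-1 : ℂ) ^ k), ← pow_succ']
      exact neg_one_pow_congr (by grind)

lemma le_of_finrank_weight_four_mul {n k : ℕ}
    (hV : n + 1 = Module.finrank ℂ (quasimodularSpace (4 * (k : ℤ)) 1 ((-1) ^ k))) :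
    k ≤ n := by
  refine le_of_isExtremal_of_independent hV
    (fun b z => if Even (k + b) then M2 z ^ (2 * (k - b)) * N4 z ^ b
      else P2 z * (M2 z ^ (2 * (k - b) - 1) * N4 z ^ b)) ?_ ?_
  · intro b hb
    by_cases hpar : Even (k + b)
    · have := mem_quasimodularSpace_of_isModular (mdiff_monomial (2 * (k - b)) b)
        (isModular_monomial (2 * (k - b)) b)
      convert this using 1
      · congr 1
        · push_cast [Nat.cast_sub hb]
          ring
        · exact neg_one_pow_congr (by grind)
      · ext z
        simp [hpar]
    · have hbk : b < k := lt_of_le_of_ne hb fun h => hpar (by rw [h]; exact Even.add_self k)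
      have := P2_mul_mem_quasimodularSpace (mdiff_monomial (2 * (k - b) - 1) b)
        (isModular_monomial (2 * (k - b) - 1) b)
      convert this using 1
      · congr 1
        · rw [Nat.cast_sub (by omega)]
          push_cast [Nat.cast_sub hb]
          ring
        · exact neg_one_pow_congr (by grind)
      · ext z
        simp [hpar]
  · intro l h
    refine coeff_eq_zero_of_sum_mul (fun b => ¬ Even (k + b)) (δ := -(-1) ^ k)
      (neg_ne_zero.mpr (pow_ne_zero _ (by norm_num))) (fun b => ?_) (fun z => ?_)
    · split_ifs with hpar
      · rw [neg_neg]
        exact neg_one_pow_congr (by grind)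
      · rw [neg_eq_neg_one_mul ((-1 : ℂ) ^ k), ← pow_succ']
        exact neg_one_pow_congr (by grind)
    · rw [← mul_zero (M2 z), ← h z, Finset.mul_sum]
      refine Finset.sum_congr rfl fun b hb => ?_
      have hb' : b ≤ k := Nat.lt_succ_iff.mp (Finset.mem_range.mp hb)
      by_cases hpar : Even (k + b)
      · simp only [hpar, not_true_eq_false, if_true, if_false]
        ring
      · have hbk : b < k := lt_of_le_of_ne hb' fun h => hpar (by rw [h]; exact Even.add_self k)
        simp only [hpar, not_false_eq_true, if_true, if_false]
        rw [show 2 * (k - b) = 2 * (k - b) - 1 + 1 by omega, pow_succ]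
        simp only [Nat.add_sub_cancel]
        ring

/-- The analytic data attached to a depth one form of high vanishing order at `i∞`. -/
lemma exists_frickePair_of_vanishingOrder {w m : ℤ} {s : ℤˣ} {f : ℍ → ℂ} {n k : ℕ}
    (hw : w = 2 * m) (hf : f ∈ quasimodularSpace w 1 s) (hn : HasVanishingOrder f n) (hk : k ≤ n) :
    ∃ f₁, FrickePair m ((s : ℤ) : ℂ) f f₁ ∧ Regular f₁ ∧ Regular (fun z => f z / M8 z ^ k) ∧
      ∃ z, f z ≠ 0 := by
  subst hw
  obtain ⟨c, rfl, hc, hF⟩ := hf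
  obtain ⟨a, ha, ha0, han⟩ := hn
  have h0 := hc 0 zero_le_one
  have hpair := hF.frickePair hc
  have hreg := (regular_div_M8_pow h0 (k := 0) ha (by simp)).1
  simp only [pow_zero, div_one] at hreg
  refine ⟨c 1, hpair, regular_of_cusps (hc 1 le_rfl) hpair.per₁ hF hreg,
    (regular_div_M8_pow h0 ha fun m hm => ha0 m (hm.trans_le hk)).1, ?_⟩
  by_contra! hz
  have := (regular_div_M8_pow h0 ha ha0).2
  simp only [hz, zero_div] at this
  exact han (tendsto_nhds_unique this tendsto_const_nhds)

lemma clearedDeriv_ellipticPt (φ : ℍ → ℂ) :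
    clearedDeriv φ ellipticPt = -32 * M8 ellipticPt * φ ellipticPt := by
  rw [clearedDeriv, M2_ellipticPt]
  linear_combination 2 * φ ellipticPt * D_M2_ellipticPt_sq

lemma hasD_div_M2 {φ : ℍ → ℂ} (h : MDiff φ) {z : ℍ} (hz : M2 z ≠ 0) :
    HasD (fun z => φ z / M2 z) ((D φ z * M2 z - φ z * D M2 z) / M2 z ^ 2) z :=
  (HasD.of_mdiff h z).div (HasD.of_mdiff mdiff_M2 z) hz

lemma solvesAt_div_M2 {φ Q : ℍ → ℂ} (h : MDiff φ) {z : ℍ} (hz : M2 z ≠ 0)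
    (hd : clearedDeriv φ z = M2 z ^ 2 * Q z * φ z) : SolvesAt Q (fun z => φ z / M2 z) z := by
  have hev : ∀ᶠ w in 𝓝 z, M2 w ≠ 0 :=
    (mdiff_M2.continuous.continuousAt (x := z)).eventually_ne hz
  refine solvesAt_of_hasD (hev.mono fun w hw => hasD_div_M2 h hw)
    ((((HasD.of_mdiff (mdiff_D h) z).mul (HasD.of_mdiff mdiff_M2 z)).sub
      ((HasD.of_mdiff h z).mul (HasD.of_mdiff (mdiff_D mdiff_M2) z))).div
      ((HasD.of_mdiff mdiff_M2 z).pow 2) (pow_ne_zero 2 hz)) ?_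
  unfold clearedDeriv at hd
  field_simp
  push_cast
  linear_combination M2 z * hd

lemma clearedDeriv_M2_mul {y φ : ℍ → ℂ} (h : MDiff y) (hφ : ∀ z, φ z = M2 z * y z) (z : ℍ) :
    clearedDeriv φ z = M2 z ^ 3 * D (D y) z := by
  have e1 : ∀ z, D φ z = D M2 z * y z + M2 z * D y z := fun z =>
    (((HasD.of_mdiff mdiff_M2 z).mul (HasD.of_mdiff h z)).congr hφ rfl).eq
  have e2 := ((((HasD.of_mdiff (mdiff_D mdiff_M2) z).mul (HasD.of_mdiff h z)).add
    ((HasD.of_mdiff mdiff_M2 z).mul (HasD.of_mdiff (mdiff_D h) z))).congr e1 rfl).eq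
  rw [clearedDeriv, e2, e1, hφ]
  ring

lemma wronskian_M2_mul {y u φ ψ : ℍ → ℂ} (hy : MDiff y) (hu : MDiff u)
    (hφ : ∀ z, φ z = M2 z * y z) (hψ : ∀ z, ψ z = M2 z * u z) (z : ℍ) :
    wronskian φ ψ z = M2 z ^ 2 * wronskian y u z := by
  rw [wronskian, wronskian, hφ, hψ,
    (((HasD.of_mdiff mdiff_M2 z).mul (HasD.of_mdiff hy z)).congr hφ rfl).eq,
    (((HasD.of_mdiff mdiff_M2 z).mul (HasD.of_mdiff hu z)).congr hψ rfl).eq]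
  ring

lemma two_mul_sq_zpow (k : ℕ) (z : ℍ) :
    (2 * (z : ℂ) ^ 2) ^ (2 * (k : ℤ)) = (4 * (z : ℂ) ^ 4) ^ k := by
  rw [zpow_mul, zpow_natCast]
  congr 1
  norm_cast
  ring

lemma two_mul_sq_ne_zero (z : ℍ) : 2 * (z : ℂ) ^ 2 ≠ 0 :=
  mul_ne_zero two_ne_zero (pow_ne_zero _ z.ne_zero)

lemma neg_one_pow_sq (k : ℕ) : ((-1 : ℂ) ^ k) ^ 2 = 1 := by
  rw [← pow_mul, mul_comm, pow_mul]
  norm_num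

/-- The second order equation in weight `4k + 2`. -/
theorem FrickePair.solvesAt_of_odd {k : ℕ} {f₀ f₁ g : ℍ → ℂ} (hg : IsM8HalfPower k g)
    (h : FrickePair (2 * k + 1) ((-1) ^ k) f₀ f₁) (h₁ : Regular f₁)
    (hdiv : Regular (fun z => f₀ z / M8 z ^ k)) (hne : ∃ z, f₀ z ≠ 0) {z : ℍ} (hz : M4 z ≠ 0) :
    SolvesAt (fun z => ((k : ℂ) / 2) ^ 2 * M4 z - 32 * (M8 z / M4 z))
      (fun z => f₀ z / (g z * M2 z)) z := by
  obtain ⟨t, σ, c, β, hts, hc, hpair, hw, hβ⟩ := exists_potential hg (neg_one_pow_sq k) h.hol₀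
    h.per₀ h₁ hdiv
    (fun z => by
      have := z.ne_zero
      rw [h.fricke₀, zpow_add_one₀ (two_mul_sq_ne_zero z), two_mul_sq_zpow]
      field_simp)
    (fun z => by rw [h.fricke₁, add_sub_cancel_right, two_mul_sq_zpow]) hne
  rw [← pow_two, neg_one_pow_sq] at hts
  have key : ∀ x : ℂ, -32 * M8 ellipticPt * x = (β * M8 ellipticPt) * x → x ≠ 0 → β = -32 := by
    intro x hx hx0
    have := mul_right_cancel₀ hx0 hx
    exact (mul_right_cancel₀ (M8_ne_zero _) this).symm
  have hell := hβ ellipticPt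
  rw [M2_ellipticPt] at hell
  have hell' : potential c (fun z => f₀ z / g z) (fun z => z * (f₀ z / g z) + f₁ z / g z)
      ellipticPt = β * M8 ellipticPt := by linear_combination hell
  have hβ' : β = -32 := by
    rcases hpair.ne_zero_ellipticPt hts hw hc with h0 | h0
    · refine key _ ?_ h0
      exact (clearedDeriv_ellipticPt _).symm.trans
        ((hpair.clearedDeriv_eq hw hc _).trans (by rw [hell']))
    · refine key _ ?_ h0
      exact (clearedDeriv_ellipticPt _).symm.trans
        ((hpair.clearedDeriv_eq' hw hc _).trans (by rw [hell']))
  rw [M4_eq_M2_sq] at hz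
  have hz' : M2 z ≠ 0 := by rintro e; simp [e] at hz
  simp_rw [← div_div]
  refine solvesAt_div_M2 hpair.hol hz' ?_
  rw [hpair.clearedDeriv_eq hw hc, hβ, hβ', M4_eq_M2_sq]
  field_simp
  ring

/-- The second order equation in weight `4k`. -/
theorem FrickePair.solvesAt_of_even {k : ℕ} {f₀ f₁ g : ℍ → ℂ} (hg : IsM8HalfPower k g)
    (h : FrickePair (2 * k) ((-1) ^ k) f₀ f₁) (h₁ : Regular f₁)
    (hdiv : Regular (fun z => f₀ z / M8 z ^ k)) (hne : ∃ z, f₀ z ≠ 0) (z : ℍ) :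
    SolvesAt (fun z => ((k : ℂ) / 2) ^ 2 * M4 z) (fun z => f₀ z / g z) z := by
  have hg0 := hg.ne_zero
  obtain ⟨t, σ, c, β, -, hc, hpair, hw, hβ⟩ := exists_potential (f₀ := fun z => M2 z * f₀ z)
    (f₁ := fun z => M2 z * f₁ z) (ε := -(-1) ^ k) hg (by rw [neg_sq, neg_one_pow_sq])
    (mdiff_mul mdiff_M2 h.hol₀)
    (fun z => by rw [regular_M2.per, h.per₀]) (regular_M2.mul h₁)
    (by simpa only [mul_div_assoc] using regular_M2.mul hdiv)
    (fun z => by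
      have := z.ne_zero
      rw [h.fricke₀, two_mul_sq_zpow, M2_fricke]
      field_simp)
    (fun z => by
      have := z.ne_zero
      rw [h.fricke₁, M2_fricke, zpow_sub_one₀ (two_mul_sq_ne_zero z), two_mul_sq_zpow]
      field_simp)
    (by
      by_contra! h0
      obtain ⟨w, hw⟩ := hne
      exact hw (M2_cancel h.hol₀ h0 w))
  have hy := mdiff_div h.hol₀ hg.1 hg0
  have hu := mdiff_add (mdiff_mul mdiff_coe hy) (mdiff_div h.hol₁ hg.1 hg0)
  have hφ : ∀ z, M2 z * f₀ z / g z = M2 z * (f₀ z / g z) := fun z => mul_div_assoc _ _ _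
  have hψ : ∀ z : ℍ, z * (M2 z * f₀ z / g z) + M2 z * f₁ z / g z =
      M2 z * (z * (f₀ z / g z) + f₁ z / g z) := fun z => by ring
  have hM : MDiff (fun z : ℍ => (((k : ℂ) / 2) ^ 2 * M2 z ^ 4 + β * M8 z : ℂ)) :=
    mdiff_add (mdiff_const_mul _ (mdiff_pow mdiff_M2 4)) (mdiff_const_mul _ mdiff_M8)
  have eq1 : ∀ z, M2 z ^ 2 * D (D fun z => f₀ z / g z) z -
      (((k : ℂ) / 2) ^ 2 * M2 z ^ 4 + β * M8 z) * (f₀ z / g z) = 0 :=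
    M2_cancel (mdiff_sub (mdiff_mul (mdiff_pow mdiff_M2 2) (mdiff_D (mdiff_D hy)))
      (mdiff_mul hM hy)) fun z => by
        have := hpair.clearedDeriv_eq hw hc z
        rw [clearedDeriv_M2_mul hy hφ, hβ] at this
        linear_combination this
  have eq2 : ∀ z : ℍ, M2 z ^ 2 * D (D fun z : ℍ => z * (f₀ z / g z) + f₁ z / g z) z -
      (((k : ℂ) / 2) ^ 2 * M2 z ^ 4 + β * M8 z) * (z * (f₀ z / g z) + f₁ z / g z) = 0 :=
    M2_cancel (mdiff_sub (mdiff_mul (mdiff_pow mdiff_M2 2) (mdiff_D (mdiff_D hu)))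
      (mdiff_mul hM hu)) fun z => by
        have := hpair.clearedDeriv_eq' hw hc z
        rw [clearedDeriv_M2_mul hu hψ, hβ] at this
        linear_combination this
  have hwr : ∀ z, wronskian (fun z => f₀ z / g z) (fun z => z * (f₀ z / g z) + f₁ z / g z) z
      - c = 0 := by
    have hd := mdiff_sub (mdiff_wronskian hy hu) (mdiff_const c)
    refine M2_cancel hd (M2_cancel (mdiff_mul mdiff_M2 hd) fun z => ?_)
    have := hw z
    rw [wronskian_M2_mul hy hu hφ hψ] at this
    linear_combination this
  have hβ' : β = 0 := by
    have e1 := eq1 ellipticPt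
    have e2 := eq2 ellipticPt
    have e3 := hwr ellipticPt
    unfold wronskian at e3
    rw [M2_ellipticPt] at e1 e2
    refine (mul_eq_zero.mp ((mul_eq_zero.mp ?_).resolve_right hc)).resolve_right
      (M8_ne_zero ellipticPt)
    generalize D (fun z => f₀ z / g z) ellipticPt = y' at *
    generalize D (fun z : ℍ => z * (f₀ z / g z) + f₁ z / g z) ellipticPt = u' at *
    linear_combination (-β * M8 ellipticPt) * e3 - u' * e1 + y' * e2
  refine solvesAt_of_hasD (Eventually.of_forall fun w => HasD.of_mdiff hy w)
    (HasD.of_mdiff (mdiff_D hy) z) ?_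
  have hd := mdiff_sub (mdiff_D (mdiff_D hy))
    (mdiff_mul (mdiff_const_mul (((k : ℂ) / 2) ^ 2) (mdiff_pow mdiff_M2 2)) hy)
  have := M2_cancel hd (M2_cancel (mdiff_mul mdiff_M2 hd) fun z => by
    have := eq1 z
    rw [hβ'] at this
    linear_combination this) z
  rw [M4_eq_M2_sq]
  linear_combination this

lemma meromorphicOn_div {F G : ℍ → ℂ} (hF : MDiff F) (hG : MDiff G) :
    MeromorphicOn ((fun z => F z / G z) ∘ ofComplex) upperHalfPlaneSet := by
  have key : ∀ {F : ℍ → ℂ}, MDiff F → MeromorphicOn (F ∘ ofComplex) upperHalfPlaneSet :=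
    fun h => ((UpperHalfPlane.mdifferentiable_iff.mp h).analyticOnNhd
      isOpen_upperHalfPlaneSet).meromorphicOn
  exact (key hF).div (key hG)

end QuasiLevelTwo

end

theorem mainTheorem6 :
    (∀ z : ℍ, QuasiLevelTwo.M4 z = QuasiLevelTwo.M2 z ^ 2) ∧
    ∀ (k : ℕ) (f g : ℍ → ℂ), QuasiLevelTwo.IsM8HalfPower k g →
      (QuasiLevelTwo.IsExtremal
          (QuasiLevelTwo.quasimodularSpace (4 * (k : ℤ)) 1 ((-1) ^ k)) f →
        ∀ z : ℍ, QuasiLevelTwo.SolvesAt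
          (fun z => ((k : ℂ) / 2) ^ 2 * QuasiLevelTwo.M4 z)
          (fun z => f z / g z) z) ∧
      (QuasiLevelTwo.IsExtremal
          (QuasiLevelTwo.quasimodularSpace (4 * (k : ℤ) + 2) 1 ((-1) ^ k)) f →
        MeromorphicOn
          ((fun z => f z / (g z * QuasiLevelTwo.M2 z)) ∘ ofComplex) upperHalfPlaneSet ∧
        ∀ z : ℍ, QuasiLevelTwo.M4 z ≠ 0 → QuasiLevelTwo.SolvesAt
          (fun z => ((k : ℂ) / 2) ^ 2 * QuasiLevelTwo.M4 z
            - 32 * (QuasiLevelTwo.M8 z / QuasiLevelTwo.M4 z))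
          (fun z => f z / (g z * QuasiLevelTwo.M2 z)) z) := by
  refine ⟨QuasiLevelTwo.M4_eq_M2_sq, fun k f g hg => ⟨?_, ?_⟩⟩
  · rintro ⟨hf, n, hn, hV⟩ z
    obtain ⟨f₁, hpair, h₁, hdiv, hne⟩ := QuasiLevelTwo.exists_frickePair_of_vanishingOrder
      (m := 2 * k) (by ring) hf hn (QuasiLevelTwo.le_of_finrank_weight_four_mul hV)
    push_cast at hpair
    exact hpair.solvesAt_of_even hg h₁ hdiv hne z
  · rintro ⟨hf, n, hn, hV⟩
    obtain ⟨f₁, hpair, h₁, hdiv, hne⟩ := QuasiLevelTwo.exists_frickePair_of_vanishingOrder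
      (m := 2 * k + 1) (by ring) hf hn
      (QuasiLevelTwo.le_of_finrank_weight_four_mul_add_two hV)
    push_cast at hpair
    exact ⟨QuasiLevelTwo.meromorphicOn_div hpair.hol₀
      (QuasiLevelTwo.mdiff_mul hg.1 QuasiLevelTwo.mdiff_M2),
      fun z hz => hpair.solvesAt_of_odd hg h₁ hdiv hne hz⟩
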